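/- Let $\mathcal C$ be a modular tensor category over $\mathbb C$, that is, a braided spherical fusion category over $\mathbb C$ (rigid, $\mathbb C$-linear, monoidal, semisimple, with finitely many isomorphism classes of simple objects, simple unit object $I$, and $\operatorname{End}(X)=\mathbb C$ for every simple $X$) with braiding $c$ and pivotal structure $j\colon V\to V^{\vee\vee}$, whose $S$-matrix $\bigl(\operatorname{ptr}(c_{X_k,X_i^\vee}\,c_{X_i^\vee,X_k})\bigr)_{i,k}$, where $X_i$ runs over representatives of the isomorphism classes of simple objects, is non-singular. Let $\theta=u^{-1}j$ be the associated twist, an automorphism of the identity functor of $\mathcal C$, where $u\colon V\to V^{\vee\vee}$ is the Drinfeld isomorphism of $c$: $$u_V=(\mathrm{ev}_V\otimes V^{\vee\vee})\,(V^\vee\otimes c_{V,V^{\vee\vee}}^{-1})\,(\mathrm{db}_{V^\vee}\otimes V)$$ (associativity isomorphisms suppressed). For an object $V$ and an integer $n\ge 1$ let $\nu_n(V)\in\mathbb C$ be the $n$-th Frobenius--Schur indicator, i.e. the trace of the linear operator $E_V^{(n)}$ on $\operatorname{Hom}(I,V^{\otimes n})$ given (associativity isomorphisms suppressed) by $$E_V^{(n)}(f)=\Bigl(I\xrightarrow{\mathrm{db}}V^\vee\otimes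 V^{\vee\vee}\xrightarrow{V^\vee\otimes f\otimes j_V^{-1}}V^\vee\otimes V\otimes V^{\otimes(n-1)}\otimes V\xrightarrow{\mathrm{ev}\otimes V^{\otimes n}}V^{\otimes n}\Bigr).$$ Let $\operatorname{FSexp}(V)\in\{1,2,\dots\}\cup\{\infty\}$ be the least $n\ge1$ such that $\nu_n(V)=d_\ell(V)$, the left pivotal dimension of $V$ (and $\infty$ if there is no such $n$), and let $\operatorname{FSexp}(\mathcal C)=\sup_{V\in\mathcal C}\operatorname{FSexp}(V)$. Then $\operatorname{FSexp}(\mathcal C)=\operatorname{ord}(\theta)$, where $\operatorname{ord}(\theta)$ is the least $n\ge 1$ with $\theta^n=\mathrm{id}$ (and $\infty$ if there is no such $n$). -/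

import Mathlib

open CategoryTheory MonoidalCategory BraidedCategory Limits

universe v u

noncomputable section

namespace FrobeniusSchur

section Duals

/-! Duals.  For each object `V` the category carries a chosen dual `dual V` with morphisms
`ev V : dual V ⊗ V ⟶ 𝟙_ C` and `coev V : 𝟙_ C ⟶ V ⊗ dual V`.  (Such a `dual V` is often called a
left dual; Mathlib calls it a right dual.) -/

variable {C : Type u} [Category.{v} C] [MonoidalCategory C] [RightRigidCategory C]

/-- The chosen dual of an object. -/
abbrev dual (V : C) : C := Vᘁ

/-- The evaluation. -/
abbrev ev (V : C) : dual V ⊗ V ⟶ 𝟙_ C := ε_ V (Vᘁ)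

/-- The dual basis morphism (coevaluation). -/
abbrev coev (V : C) : 𝟙_ C ⟶ V ⊗ dual V := η_ V (Vᘁ)

/-- The transpose of a morphism. -/
abbrev dualMap {V W : C} (f : V ⟶ W) : dual W ⟶ dual V := fᘁ

/-- The canonical isomorphism `dual (V ⊗ W) ≅ dual W ⊗ dual V`. -/
def dualTensorIso (V W : C) : dual (V ⊗ W) ≅ dual W ⊗ dual V := rightDualTensorIso V W

/-- The canonical isomorphism `dual (𝟙_ C) ≅ 𝟙_ C`. -/
def dualUnitIso (C : Type u) [Category.{v} C] [MonoidalCategory C] [RightRigidCategory C] :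
    dual (𝟙_ C) ≅ 𝟙_ C :=
  rightDualIso (RightRigidCategory.rightDual (𝟙_ C)).exact exactPairingUnit

end Duals

/-- A pivotal structure: an isomorphism of monoidal functors from the identity to the double dual
functor.  `map_unit` and `map_tensor` express the compatibility with the monoidal structure
`𝟙 ≅ dual 𝟙 ≅ dual (dual 𝟙)` and
`dual (dual V) ⊗ dual (dual W) ≅ dual (dual W ⊗ dual V) ≅ dual (dual (V ⊗ W))`
of the double dual functor. -/
class PivotalCategory (C : Type u) [Category.{v} C] [MonoidalCategory C]
    [RightRigidCategory C] where
  j : ∀ V : C, V ≅ dual (dual V)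
  naturality : ∀ {V W : C} (f : V ⟶ W), f ≫ (j W).hom = (j V).hom ≫ dualMap (dualMap f)
  map_unit : (j (𝟙_ C)).hom ≫ dualMap (dualUnitIso C).inv = (dualUnitIso C).inv
  map_tensor : ∀ V W : C, (j (V ⊗ W)).hom ≫ dualMap (dualTensorIso V W).inv =
    ((j V).hom ⊗ₘ (j W).hom) ≫ (dualTensorIso (dual W) (dual V)).inv

section Pivotal

variable {C : Type u} [Category.{v} C] [MonoidalCategory C] [RightRigidCategory C]
  [PivotalCategory C]

open PivotalCategory

/-- The right pivotal trace. -/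
def rightTrace {V : C} (f : V ⟶ V) : 𝟙_ C ⟶ 𝟙_ C :=
  coev V ≫ f ▷ dual V ≫ (j V).hom ▷ dual V ≫ ev (dual V)

/-- The left pivotal trace. -/
def leftTrace {V : C} (f : V ⟶ V) : 𝟙_ C ⟶ 𝟙_ C :=
  coev (dual V) ≫ dual V ◁ (j V).inv ≫ dual V ◁ f ≫ ev V

/-- The left pivotal dimension, as an endomorphism of the unit object. -/
def leftDim (V : C) : 𝟙_ C ⟶ 𝟙_ C := leftTrace (𝟙 V)

variable (C) in
/-- A pivotal category is spherical if left and right traces of all endomorphisms agree. -/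
class Spherical : Prop where
  leftTrace_eq_rightTrace : ∀ {V : C} (f : V ⟶ V), leftTrace f = rightTrace f

end Pivotal

section Indicators

/-- The tensor power `V ⊗ (V ⊗ (⋯ ⊗ (V ⊗ 𝟙)))` with `n` factors `V`. -/
def tensorPow {C : Type u} [Category.{v} C] [MonoidalCategory C] (V : C) : ℕ → C
  | 0 => 𝟙_ C
  | n + 1 => V ⊗ tensorPow V n

/-- The rebracketing isomorphism `(V ⊗ ⋯ ⊗ V) ⊗ V ≅ V ⊗ (V ⊗ ⋯ ⊗ V)`. -/
def tensorPowComm {C : Type u} [Category.{v} C] [MonoidalCategory C] (V : C) :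
    ∀ n : ℕ, tensorPow V n ⊗ V ≅ V ⊗ tensorPow V n
  | 0 => λ_ V ≪≫ (ρ_ V).symm
  | n + 1 => α_ V (tensorPow V n) V ≪≫ whiskerLeftIso V (tensorPowComm V n)

variable (k : Type*) [Field k]
variable {C : Type u} [Category.{v} C] [Preadditive C] [Linear k C] [MonoidalCategory C]
  [MonoidalPreadditive C] [MonoidalLinear k C] [RightRigidCategory C] [PivotalCategory C]

open PivotalCategory

/-- The map `E_{V,W} : Hom(𝟙, V ⊗ W) → Hom(𝟙, W ⊗ V)` that bends the factor `V` around from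
the left to the right, using the pivotal structure. -/
def bend (V W : C) : (𝟙_ C ⟶ V ⊗ W) →ₗ[k] (𝟙_ C ⟶ W ⊗ V) where
  toFun f :=
    coev (dual V) ≫ dual V ◁ (j V).inv ≫
      ((ρ_ (dual V)).inv ≫ dual V ◁ f ≫ (α_ (dual V) V W).inv ≫ ev V ▷ W ≫ (λ_ W).hom) ▷ V
  map_add' f g := by simp [MonoidalPreadditive.whiskerLeft_add, MonoidalPreadditive.add_whiskerRight]
  map_smul' c f := by simp

/-- The operator `E_V^{(n+1)}` on `Hom(𝟙, V^{⊗(n+1)})`. -/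
def fsOperator (V : C) (n : ℕ) :
    (𝟙_ C ⟶ tensorPow V (n + 1)) →ₗ[k] (𝟙_ C ⟶ tensorPow V (n + 1)) :=
  Linear.rightComp k (𝟙_ C) (tensorPowComm V n).hom ∘ₗ bend k V (tensorPow V n)

/-- The `n`-th Frobenius-Schur indicator of `V`, for `n ≥ 1`: the trace of `E_V^{(n)}`.
(The value at `n = 0` is a placeholder and is never used.) -/
def fsIndicator (V : C) : ℕ → k
  | 0 => 0
  | n + 1 => LinearMap.trace k (𝟙_ C ⟶ tensorPow V (n + 1)) (fsOperator k V n)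

/-- The Frobenius-Schur exponent of an object: the least `n ≥ 1` for which the `n`-th indicator is
the left pivotal dimension, and `∞` if there is none.  Endomorphisms of the unit object are compared
with scalars by `c ↦ c • 𝟙`. -/
def fsExpObj (V : C) : ℕ∞ :=
  ⨅ (n : ℕ) (_ : 0 < n ∧ fsIndicator k V n • 𝟙 (𝟙_ C) = leftDim V), (n : ℕ∞)

variable (C) in
/-- The Frobenius-Schur exponent of a category: the supremum of the exponents of its objects. -/
def fsExp : ℕ∞ := ⨆ V : C, fsExpObj k V

end Indicators

section Twist

variable {C : Type u} [Category.{v} C] [MonoidalCategory C] [BraidedCategory C]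
  [RightRigidCategory C]

/-- The Drinfeld morphism `u_V : V ⟶ dual (dual V)`. -/
def drinfeldHom (V : C) : V ⟶ dual (dual V) :=
  (λ_ V).inv ≫ coev (dual V) ▷ V ≫ (α_ (dual V) (dual (dual V)) V).hom ≫
    dual V ◁ (β_ V (dual (dual V))).inv ≫ (α_ (dual V) V (dual (dual V))).inv ≫
      ev V ▷ dual (dual V) ≫ (λ_ (dual (dual V))).hom

lemma drinfeldHom_naturality {V W : C} (f : V ⟶ W) :
    f ≫ drinfeldHom W = drinfeldHom V ≫ dualMap (dualMap f) := by
  have e1 : dual W ◁ f ≫ ev W = dualMap f ▷ V ≫ ev V := (rightAdjointMate_comp_evaluation f).symm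
  have e2 : coev (dual W) ≫ dualMap f ▷ dual (dual W) =
      coev (dual V) ≫ dual V ◁ dualMap (dualMap f) :=
    (coevaluation_comp_rightAdjointMate (dualMap f)).symm
  have b1 : dual (dual W) ◁ f ≫ (β_ W (dual (dual W))).inv =
      (β_ V (dual (dual W))).inv ≫ f ▷ dual (dual W) := by
    simp
  have b2 : dualMap (dualMap f) ▷ V ≫ (β_ V (dual (dual W))).inv =
      (β_ V (dual (dual V))).inv ≫ V ◁ dualMap (dualMap f) := by
    simp
  calc f ≫ drinfeldHom W
      = 𝟙 _ ⊗≫ (𝟙_ C ◁ f ≫ coev (dual W) ▷ W) ⊗≫ dual W ◁ (β_ W (dual (dual W))).inv ⊗≫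
          ev W ▷ dual (dual W) ⊗≫ 𝟙 _ := by dsimp only [drinfeldHom]; monoidal
    _ = 𝟙 _ ⊗≫ coev (dual W) ▷ V ⊗≫
          dual W ◁ (dual (dual W) ◁ f ≫ (β_ W (dual (dual W))).inv) ⊗≫
          ev W ▷ dual (dual W) ⊗≫ 𝟙 _ := by rw [whisker_exchange]; monoidal
    _ = 𝟙 _ ⊗≫ coev (dual W) ▷ V ⊗≫ dual W ◁ (β_ V (dual (dual W))).inv ⊗≫
          (dual W ◁ f ≫ ev W) ▷ dual (dual W) ⊗≫ 𝟙 _ := by rw [b1]; monoidal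
    _ = 𝟙 _ ⊗≫ coev (dual W) ▷ V ⊗≫
          (dual W ◁ (β_ V (dual (dual W))).inv ≫ dualMap f ▷ (V ⊗ dual (dual W))) ⊗≫
          ev V ▷ dual (dual W) ⊗≫ 𝟙 _ := by rw [e1]; monoidal
    _ = 𝟙 _ ⊗≫ (coev (dual W) ≫ dualMap f ▷ dual (dual W)) ▷ V ⊗≫
          dual V ◁ (β_ V (dual (dual W))).inv ⊗≫
          ev V ▷ dual (dual W) ⊗≫ 𝟙 _ := by rw [whisker_exchange]; monoidal
    _ = 𝟙 _ ⊗≫ coev (dual V) ▷ V ⊗≫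
          dual V ◁ (dualMap (dualMap f) ▷ V ≫ (β_ V (dual (dual W))).inv) ⊗≫
          ev V ▷ dual (dual W) ⊗≫ 𝟙 _ := by rw [e2]; monoidal
    _ = 𝟙 _ ⊗≫ coev (dual V) ▷ V ⊗≫ dual V ◁ (β_ V (dual (dual V))).inv ⊗≫
          ((dual V ⊗ V) ◁ dualMap (dualMap f) ≫ ev V ▷ dual (dual W)) ⊗≫ 𝟙 _ := by
        rw [b2]; monoidal
    _ = drinfeldHom V ≫ dualMap (dualMap f) := by
        rw [whisker_exchange]; dsimp only [drinfeldHom]; monoidal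

instance (V : C) : IsIso (drinfeldHom V) := by
  have hb : V ◁ coev (dual V) ≫ (α_ _ _ _).inv ≫ (β_ V (dual V)).hom ▷ dual (dual V) =
      (ρ_ V).hom ≫ (λ_ V).inv ≫ coev (dual V) ▷ V ≫ (α_ _ _ _).hom ≫
        dual V ◁ (β_ V (dual (dual V))).inv ≫ (α_ _ _ _).inv := by
    have h1 := braiding_naturality_right V (coev (dual V))
    rw [braiding_tensor_right_hom, braiding_tensorUnit_right] at h1
    have h2 : V ◁ coev (dual V) ≫ (α_ _ _ _).inv ≫ (β_ V (dual V)).hom ▷ dual (dual V) ≫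
        (α_ _ _ _).hom ≫ dual V ◁ (β_ V (dual (dual V))).hom =
        (ρ_ V).hom ≫ (λ_ V).inv ≫ coev (dual V) ▷ V ≫ (α_ _ _ _).hom := by
      rw [← cancel_mono (α_ (dual V) (dual (dual V)) V).inv]
      simpa using h1
    rw [← cancel_mono (α_ _ _ _).hom, ← cancel_mono (dual V ◁ (β_ V (dual (dual V))).hom)]
    simpa using h2
  have h : drinfeldHom V = (rightDualIso (exactPairing_swap V (dual V))
      (RightRigidCategory.rightDual (dual V)).exact).hom := by
    have h3 : (rightDualIso (exactPairing_swap V (dual V))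
        (RightRigidCategory.rightDual (dual V)).exact).hom =
        (ρ_ V).inv ≫ V ◁ coev (dual V) ≫ V ◁ (𝟙 (dual V)) ▷ dual (dual V) ≫
          (α_ V (dual V) (dual (dual V))).inv ≫
          ((β_ V (dual V)).hom ≫ ev V) ▷ dual (dual V) ≫ (λ_ _).hom := rfl
    rw [h3]
    have h4 := (ρ_ V).inv ≫= (hb =≫ (ev V ▷ dual (dual V) ≫ (λ_ _).hom))
    simp only [Category.assoc, Iso.inv_hom_id_assoc] at h4
    simp only [id_whiskerRight, MonoidalCategory.whiskerLeft_id, Category.id_comp,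
      comp_whiskerRight, Category.assoc]
    rw [h4]
    rfl
  rw [h]
  infer_instance

variable (C) in
/-- The twist `θ = u⁻¹ j` associated with the pivotal structure of a braided pivotal category, as an
automorphism of the identity functor. -/
def twist [PivotalCategory C] : Aut (𝟭 C) :=
  NatIso.ofComponents (fun V => PivotalCategory.j V ≪≫ (asIso (drinfeldHom V)).symm) (by
    intro V W f
    have h : dualMap (dualMap f) ≫ inv (drinfeldHom W) = inv (drinfeldHom V) ≫ f := by
      rw [IsIso.comp_inv_eq, Category.assoc, drinfeldHom_naturality, IsIso.inv_hom_id_assoc]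
    have h' := PivotalCategory.naturality f
    simp only [Functor.id_obj, Functor.id_map, Iso.trans_hom, Iso.symm_hom, asIso_inv,
      Category.assoc]
    rw [← Category.assoc, h', Category.assoc, h])

end Twist

/-- The order of an element of a group: the least `n ≥ 1` with `g ^ n = 1`, and `∞` if there is
none. -/
def order {G : Type*} [Group G] (g : G) : ℕ∞ := ⨅ (n : ℕ) (_ : 0 < n ∧ g ^ n = 1), (n : ℕ∞)

section Fusion

attribute [local instance] Abelian.hasFiniteBiproducts

variable (C : Type u) [Category.{v} C] [Abelian C] [Linear ℂ C] [MonoidalCategory C]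
  [MonoidalPreadditive C] [MonoidalLinear ℂ C] [RightRigidCategory C]

variable {C} in
/-- `X` lists every simple object exactly once, up to isomorphism. -/
structure IsCompleteListOfSimples {n : ℕ} (X : Fin n → C) : Prop where
  simple : ∀ i, Simple (X i)
  eq_of_iso : ∀ i i', Nonempty (X i ≅ X i') → i = i'
  exists_iso : ∀ V : C, Simple V → ∃ i, Nonempty (V ≅ X i)

/-- A fusion category over `ℂ`: a rigid `ℂ`-linear monoidal category that is semisimple with
finitely many simple objects up to isomorphism, all of which have endomorphism ring `ℂ`, and with a
simple unit object.  (One-sided duals suffice here: in a pivotal category they are two-sided.) -/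
class FusionCategory : Prop where
  unit_simple : Simple (𝟙_ C)
  semisimple : ∀ V : C, ∃ (n : ℕ) (X : Fin n → C), (∀ i, Simple (X i)) ∧ Nonempty (V ≅ ⨁ X)
  finitely_many_simples : ∃ (n : ℕ) (X : Fin n → C), IsCompleteListOfSimples X
  end_simple : ∀ V : C, Simple V → Module.finrank ℂ (V ⟶ V) = 1

/-- A modular tensor category: a spherical braided fusion category whose `S`-matrix, with entries
the traces of the double braidings of `dual (X i)` and `X i'`, is non-singular.  (The customary
normalizing factor is omitted, as it does not affect non-singularity.  Endomorphisms of the unit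
object are scalars; the matrix does not depend on the choice of the `X i`, up to reindexing.) -/
class ModularTensorCategory [BraidedCategory C] [PivotalCategory C] : Prop
    extends FusionCategory C, Spherical C where
  sMatrix_nonsingular : ∀ (n : ℕ) (X : Fin n → C), IsCompleteListOfSimples X →
    ∀ s : Matrix (Fin n) (Fin n) ℂ,
      (∀ i i', s i i' • 𝟙 (𝟙_ C) =
        leftTrace ((β_ (dual (X i)) (X i')).hom ≫ (β_ (X i') (dual (X i))).hom)) →
      s.det ≠ 0

end Fusion

end FrobeniusSchur

end

/-!
# The Frobenius-Schur exponent of a modular tensor category is the order of the twist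

The operator `E_V^{(n)}` rotates a morphism `f : 𝟙 ⟶ V^{⊗n}` by bending its first strand around to
the end.  Pulling this strand across `f` by the naturality of the braiding leaves a curl, so
`E_V^{(n)}` is composition with the cyclic braid on `n` strands, framed by a twist of the moving
strand (`fsOperator_eq`).  The indicator is thus the trace of that braid over `Hom(𝟙, V^{⊗n})`.

In a modular category the sum of all loops coloured by simple objects `X i`, weighted by the
dimensions of the `X i`, acts on an object as `globalDim X` times the projection to the part
isomorphic to a sum of copies of `𝟙` (`sum_dim_mul_encircleScalar`).  So `globalDim X` times the
indicator is the weighted sum over `i` of the traces of the twisted cyclic braid with a loop `X i`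
around all its strands.  Closing up these strands one by one, where each crossing becomes a curl,
leaves a single strand `V` that winds `n` times around `X i` (`encircledClosure_cyclicBraid_comp`);
by the balancing axiom the winding is expressed by the twists of `X i ⊗ V` and `X i`.  The result
is Bantay's formula (`globalDim_mul_fsIndicator`):

  `globalDim X * ν_n(V) = ∑ i, dim (X i) * θ_i ^ (-n) * tr (θ_{X i ⊗ V} ^ n)`.

If `θ ^ n = 1`, the right-hand side is `∑ i, dim (X i) * dim (X i ⊗ V) = globalDim X * dim V`,
hence `ν_n(V) = dim V` for all `V`.  Conversely, if `ν_n(X k) = dim (X k)` for all simple objects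
`X k`, then summing Bantay's formula with weights `dim (X k)` gives

  `∑ i, ∑ j, dim (X i) ^ 2 * dim (X j) ^ 2 * (θ_j / θ_i) ^ n = (∑ i, dim (X i) ^ 2) ^ 2`.

The dimensions are real (`conj_dim`) and not zero (`dim_ne_zero`), and the `θ_i` have absolute
value one (`norm_theta`, by the determinant argument of Vafa), so all `(θ_j / θ_i) ^ n` are one;
taking `X i = 𝟙` gives `θ ^ n = 1` (`theta_pow_eq_one`).

This shows that the exponent of every object is at most the order of the twist.  For the supremum
to reach the order, a single object has to fail the condition `ν_n(V) = dim V` for all `n` up to a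
given bound.  Since indicators and dimensions are additive in `V`, a direct sum of `t ^ k` copies
of each `X k` does so for a suitable natural number `t` (`exists_fsIndicator_ne_dim`).
-/

set_option linter.unusedSectionVars false

noncomputable section

namespace FrobeniusSchur

/-! ### Pivotal evaluations and partial traces -/

section PivotalTraces

section RightDualIso

variable {C : Type u} [Category.{v} C] [MonoidalCategory C]

lemma coevaluation_comp_rightDualIso {X Y₁ Y₂ : C} (p₁ : ExactPairing X Y₁)
    (p₂ : ExactPairing X Y₂) :
    p₁.coevaluation' ≫ X ◁ (rightDualIso p₁ p₂).hom = p₂.coevaluation' := by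
  have h := @coevaluation_comp_rightAdjointMate C _ _ X X ⟨Y₂⟩ ⟨Y₁⟩ (𝟙 X)
  rw [id_whiskerRight, Category.comp_id] at h
  exact h

lemma rightDualIso_comp_evaluation {X Y₁ Y₂ : C} (p₁ : ExactPairing X Y₁)
    (p₂ : ExactPairing X Y₂) :
    (rightDualIso p₁ p₂).hom ▷ X ≫ p₂.evaluation' = p₁.evaluation' := by
  have h := @rightAdjointMate_comp_evaluation C _ _ X X ⟨Y₂⟩ ⟨Y₁⟩ (𝟙 X)
  rw [MonoidalCategory.whiskerLeft_id, Category.id_comp] at h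
  exact h

end RightDualIso

variable {C : Type u} [Category.{v} C] [MonoidalCategory C] [RightRigidCategory C]

lemma dualMap_comp {V W Z : C} (f : V ⟶ W) (g : W ⟶ Z) :
    dualMap (f ≫ g) = dualMap g ≫ dualMap f := comp_rightAdjointMate

lemma dualMap_id (V : C) : dualMap (𝟙 V) = 𝟙 (dual V) := rightAdjointMate_id

lemma coev_dualMap {V W : C} (f : V ⟶ W) :
    coev W ≫ W ◁ dualMap f = coev V ≫ f ▷ dual V := coevaluation_comp_rightAdjointMate f

lemma dualMap_ev {V W : C} (f : V ⟶ W) :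
    dualMap f ▷ V ≫ ev V = dual W ◁ f ≫ ev W := rightAdjointMate_comp_evaluation f

lemma zigzag_coev_ev (V : C) : coev V ▷ V ⊗≫ V ◁ ev V = ⊗𝟙.hom :=
  ExactPairing.evaluation_coevaluation'' V (dual V)

lemma zigzag_ev_coev (V : C) : dual V ◁ coev V ⊗≫ ev V ▷ dual V = ⊗𝟙.hom :=
  ExactPairing.coevaluation_evaluation'' V (dual V)

/-- A morphism to `dual V` is determined by its composite with the evaluation. -/
lemma eq_of_whiskerRight_ev {A V : C} {f g : A ⟶ dual V} (h : f ▷ V ≫ ev V = g ▷ V ≫ ev V) :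
    f = g := by
  have key : ∀ f : A ⟶ dual V, f = 𝟙 _ ⊗≫ A ◁ coev V ⊗≫ (f ▷ V ≫ ev V) ▷ dual V ⊗≫ 𝟙 _ := by
    intro f
    calc f = f ⊗≫ (dual V ◁ coev V ⊗≫ ev V ▷ dual V) ⊗≫ 𝟙 _ := by
          rw [zigzag_ev_coev]; monoidal
      _ = 𝟙 _ ⊗≫ (f ▷ 𝟙_ C ≫ dual V ◁ coev V) ⊗≫ ev V ▷ dual V ⊗≫ 𝟙 _ := by monoidal
      _ = _ := by rw [← whisker_exchange]; monoidal
  rw [key f, key g, h]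

lemma coev_tensor (V W : C) :
    coev (V ⊗ W) ≫ (V ⊗ W) ◁ (dualTensorIso V W).hom =
      coev V ⊗≫ (V ◁ coev W) ▷ dual V ⊗≫ 𝟙 _ :=
  coevaluation_comp_rightDualIso _ _

lemma ev_tensor (V W : C) :
    (dualTensorIso V W).hom ▷ (V ⊗ W) ≫ (𝟙 _ ⊗≫ dual W ◁ (ev V ▷ W) ⊗≫ ev W) = ev (V ⊗ W) :=
  rightDualIso_comp_evaluation _ _

lemma coev_unit : coev (𝟙_ C) ≫ 𝟙_ C ◁ (dualUnitIso C).hom = (ρ_ _).inv :=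
  coevaluation_comp_rightDualIso _ _

lemma ev_unit : (dualUnitIso C).hom ▷ 𝟙_ C ≫ (ρ_ _).hom = ev (𝟙_ C) :=
  rightDualIso_comp_evaluation _ _

lemma dualMap_ev_eq (V : C) :
    dualMap (ev V) = (dualUnitIso C).hom ≫ coev (dual V) ≫ (dualTensorIso (dual V) V).inv := by
  apply eq_of_whiskerRight_ev
  have h1 : (dualTensorIso (dual V) V).inv ▷ (dual V ⊗ V) ≫ ev (dual V ⊗ V) =
      𝟙 _ ⊗≫ dual V ◁ (ev (dual V) ▷ V) ⊗≫ ev V := by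
    rw [← ev_tensor, ← comp_whiskerRight_assoc, Iso.inv_hom_id, id_whiskerRight, Category.id_comp]
  calc dualMap (ev V) ▷ (dual V ⊗ V) ≫ ev (dual V ⊗ V)
      = (dual (𝟙_ C) ◁ ev V ≫ (dualUnitIso C).hom ▷ 𝟙_ C) ≫ (ρ_ _).hom := by
        rw [dualMap_ev, ← ev_unit, Category.assoc]
    _ = (dualUnitIso C).hom ▷ (dual V ⊗ V) ⊗≫
          (coev (dual V) ▷ dual V ⊗≫ dual V ◁ ev (dual V)) ▷ V ⊗≫ ev V := by
        rw [whisker_exchange, zigzag_coev_ev]; monoidal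
    _ = (dualUnitIso C).hom ▷ (dual V ⊗ V) ≫ coev (dual V) ▷ (dual V ⊗ V) ≫
          (𝟙 _ ⊗≫ dual V ◁ (ev (dual V) ▷ V) ⊗≫ ev V) := by monoidal
    _ = _ := by rw [← h1]; simp only [comp_whiskerRight, Category.assoc]

variable [PivotalCategory C]

open PivotalCategory

/-- The pivotal evaluation `V ⊗ dual V ⟶ 𝟙_ C`, on the other side of `ev V`. -/
def capR (V : C) : V ⊗ dual V ⟶ 𝟙_ C := (j V).hom ▷ dual V ≫ ev (dual V)

/-- The pivotal coevaluation `𝟙_ C ⟶ dual V ⊗ V`, on the other side of `coev V`. -/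
def cupL (V : C) : 𝟙_ C ⟶ dual V ⊗ V := coev (dual V) ≫ dual V ◁ (j V).inv

lemma j_inv_naturality {V W : C} (f : V ⟶ W) :
    dualMap (dualMap f) ≫ (j W).inv = (j V).inv ≫ f := by
  rw [Iso.comp_inv_eq, Category.assoc, naturality, Iso.inv_hom_id_assoc]

lemma capR_naturality {V W : C} (f : V ⟶ W) :
    f ▷ dual W ≫ capR W = V ◁ dualMap f ≫ capR V := by
  calc f ▷ dual W ≫ capR W = (f ≫ (j W).hom) ▷ dual W ≫ ev (dual W) := by
        simp [capR]
    _ = (j V).hom ▷ dual W ≫ (dualMap (dualMap f) ▷ dual W ≫ ev (dual W)) := by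
        rw [naturality]; simp
    _ = ((j V).hom ▷ dual W ≫ dual (dual V) ◁ dualMap f) ≫ ev (dual V) := by
        rw [dualMap_ev]; simp
    _ = V ◁ dualMap f ≫ capR V := by rw [← whisker_exchange]; simp [capR]

lemma cupL_naturality {V W : C} (f : V ⟶ W) :
    cupL W ≫ dualMap f ▷ W = cupL V ≫ dual V ◁ f := by
  calc cupL W ≫ dualMap f ▷ W
      = coev (dual W) ≫ (dual W ◁ (j W).inv ≫ dualMap f ▷ W) := by simp [cupL]
    _ = (coev (dual W) ≫ dualMap f ▷ dual (dual W)) ≫ dual V ◁ (j W).inv := by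
        rw [whisker_exchange]; simp
    _ = coev (dual V) ≫ dual V ◁ (dualMap (dualMap f) ≫ (j W).inv) := by
        rw [← coev_dualMap]; simp
    _ = _ := by rw [j_inv_naturality]; simp [cupL]

lemma j_tensor (V W : C) : (j (V ⊗ W)).hom =
    ((j V).hom ⊗ₘ (j W).hom) ≫ (dualTensorIso (dual W) (dual V)).inv ≫
      dualMap (dualTensorIso V W).hom := by
  rw [← Category.assoc, ← map_tensor, Category.assoc, ← dualMap_comp, Iso.hom_inv_id, dualMap_id,
    Category.comp_id]

lemma j_tensor_inv (V W : C) : dualMap (dualTensorIso V W).hom ≫ (j (V ⊗ W)).inv =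
    (dualTensorIso (dual W) (dual V)).hom ≫ ((j V).inv ⊗ₘ (j W).inv) := by
  rw [Iso.comp_inv_eq, j_tensor]
  simp

lemma capR_tensor (V W : C) :
    (V ⊗ W) ◁ (dualTensorIso V W).inv ≫ capR (V ⊗ W) =
      𝟙 _ ⊗≫ V ◁ (capR W ▷ dual V) ⊗≫ capR V := by
  set e := dualTensorIso V W
  set e' := dualTensorIso (dual W) (dual V) with he'
  have h1 : e'.inv ▷ (dual W ⊗ dual V) ≫ ev (dual W ⊗ dual V) =
      𝟙 _ ⊗≫ dual (dual V) ◁ (ev (dual W) ▷ dual V) ⊗≫ ev (dual V) := by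
    rw [← ev_tensor, ← comp_whiskerRight_assoc, Iso.inv_hom_id, id_whiskerRight, Category.id_comp]
  have h2 : (V ⊗ W) ◁ e.inv ≫ ((j V).hom ⊗ₘ (j W).hom) ▷ dual (V ⊗ W) =
      ((j V).hom ⊗ₘ (j W).hom) ▷ (dual W ⊗ dual V) ≫ (dual (dual V) ⊗ dual (dual W)) ◁ e.inv :=
    whisker_exchange _ _
  have h3 : (dual (dual V) ⊗ dual (dual W)) ◁ e.inv ≫ e'.inv ▷ dual (V ⊗ W) =
      e'.inv ▷ (dual W ⊗ dual V) ≫ dual (dual W ⊗ dual V) ◁ e.inv := whisker_exchange _ _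
  calc (V ⊗ W) ◁ e.inv ≫ capR (V ⊗ W)
      = ((V ⊗ W) ◁ e.inv ≫ ((j V).hom ⊗ₘ (j W).hom) ▷ dual (V ⊗ W)) ≫
          e'.inv ▷ dual (V ⊗ W) ≫ dualMap e.hom ▷ dual (V ⊗ W) ≫ ev (dual (V ⊗ W)) := by
        rw [capR, j_tensor]; simp only [comp_whiskerRight, Category.assoc, e, e']
    _ = ((j V).hom ⊗ₘ (j W).hom) ▷ (dual W ⊗ dual V) ≫ e'.inv ▷ (dual W ⊗ dual V) ≫
          dual (dual W ⊗ dual V) ◁ (e.inv ≫ e.hom) ≫ ev (dual W ⊗ dual V) := by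
        rw [h2, dualMap_ev, Category.assoc, reassoc_of% h3, MonoidalCategory.whiskerLeft_comp,
          Category.assoc]
    _ = ((j V).hom ⊗ₘ (j W).hom) ▷ (dual W ⊗ dual V) ≫
         (𝟙 _ ⊗≫ dual (dual V) ◁ (ev (dual W) ▷ dual V) ⊗≫ ev (dual V)) := by
        rw [Iso.inv_hom_id, MonoidalCategory.whiskerLeft_id, Category.id_comp, h1]
    _ = 𝟙 _ ⊗≫ V ◁ (((j W).hom ▷ dual W) ▷ dual V) ⊗≫
          ((j V).hom ▷ ((dual (dual W) ⊗ dual W) ⊗ dual V) ≫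
            dual (dual V) ◁ (ev (dual W) ▷ dual V)) ⊗≫ ev (dual V) := by
        rw [tensorHom_def']; monoidal
    _ = _ := by
        rw [← whisker_exchange]; simp only [capR]; monoidal

lemma cupL_tensor (V W : C) :
    cupL (V ⊗ W) ≫ (dualTensorIso V W).hom ▷ (V ⊗ W) =
      cupL W ⊗≫ dual W ◁ (cupL V ▷ W) ⊗≫ 𝟙 _ := by
  set e := dualTensorIso V W with he
  set e' := dualTensorIso (dual W) (dual V) with he'
  have h := coev_tensor (dual W) (dual V)
  rw [← he'] at h
  calc cupL (V ⊗ W) ≫ e.hom ▷ (V ⊗ W)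
      = (coev (dual (V ⊗ W)) ≫ e.hom ▷ dual (dual (V ⊗ W))) ≫
          (dual W ⊗ dual V) ◁ (j (V ⊗ W)).inv := by
        rw [cupL, Category.assoc, Category.assoc, whisker_exchange]
    _ = coev (dual W ⊗ dual V) ≫ (dual W ⊗ dual V) ◁ (dualMap e.hom ≫ (j (V ⊗ W)).inv) := by
        rw [← coev_dualMap]; simp only [MonoidalCategory.whiskerLeft_comp, Category.assoc]
    _ = (coev (dual W ⊗ dual V) ≫ (dual W ⊗ dual V) ◁ e'.hom) ≫
          (dual W ⊗ dual V) ◁ ((j V).inv ⊗ₘ (j W).inv) := by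
        rw [j_tensor_inv]; simp only [MonoidalCategory.whiskerLeft_comp, Category.assoc, e']
    _ = coev (dual W) ⊗≫ (dual W ◁ coev (dual V) ▷ dual (dual W) ≫
          dual W ◁ (dual V ⊗ dual (dual V)) ◁ (j W).inv) ⊗≫
           dual W ◁ (dual V ◁ (j V).inv) ▷ W ⊗≫ 𝟙 _ := by
        rw [h, tensorHom_def']; monoidal
    _ = _ := by
        rw [← MonoidalCategory.whiskerLeft_comp, ← whisker_exchange]; simp only [cupL]; monoidal

lemma coev_comp_capR_unit : coev (𝟙_ C) ≫ capR (𝟙_ C) = 𝟙 _ := by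
  set e := dualUnitIso C
  have h1 : (j (𝟙_ C)).hom = e.inv ≫ dualMap e.hom := by
    rw [← map_unit, Category.assoc, ← dualMap_comp, Iso.hom_inv_id, dualMap_id, Category.comp_id]
  calc coev (𝟙_ C) ≫ capR (𝟙_ C)
      = coev (𝟙_ C) ≫ (e.inv ▷ dual (𝟙_ C) ≫ dual (𝟙_ C) ◁ e.hom) ≫ ev (𝟙_ C) := by
        rw [capR, h1]; simp only [comp_whiskerRight, Category.assoc, dualMap_ev]
    _ = (coev (𝟙_ C) ≫ 𝟙_ C ◁ e.hom) ≫ e.inv ▷ 𝟙_ C ≫ ev (𝟙_ C) := by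
        rw [← whisker_exchange]; simp only [Category.assoc]
    _ = 𝟙 _ := by
        rw [coev_unit, ← ev_unit, ← comp_whiskerRight_assoc, Iso.inv_hom_id]; simp

lemma capR_unit : 𝟙_ C ◁ (dualUnitIso C).inv ≫ capR (𝟙_ C) = (ρ_ (𝟙_ C)).hom := by
  have h : coev (𝟙_ C) = (ρ_ _).inv ≫ 𝟙_ C ◁ (dualUnitIso C).inv := by
    rw [← coev_unit, Category.assoc, ← MonoidalCategory.whiskerLeft_comp, Iso.hom_inv_id,
      MonoidalCategory.whiskerLeft_id, Category.comp_id]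
  have h1 := coev_comp_capR_unit (C := C)
  rw [h, Category.assoc, Iso.inv_comp_eq, Category.comp_id] at h1
  exact h1

/-- Up to the pivotal structure, the pivotal evaluation of `dual V` is the evaluation of `V`.  This
follows from the naturality of `capR` at `ev V` and from its compatibility with tensor products. -/
lemma j_comp_capR_dual (V : C) : dual V ◁ (j V).hom ≫ capR (dual V) = ev V := by
  have hz : V ◁ coev (dual V) ⊗≫ capR V ▷ dual (dual V) = 𝟙 _ ⊗≫ (j V).hom ⊗≫ 𝟙 _ := by
    calc V ◁ coev (dual V) ⊗≫ capR V ▷ dual (dual V)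
        = 𝟙 _ ⊗≫ (V ◁ coev (dual V) ≫ (j V).hom ▷ (dual V ⊗ dual (dual V))) ⊗≫
            ev (dual V) ▷ dual (dual V) := by simp only [capR]; monoidal
      _ = 𝟙 _ ⊗≫ (j V).hom ⊗≫
            (dual (dual V) ◁ coev (dual V) ⊗≫ ev (dual V) ▷ dual (dual V)) ⊗≫ 𝟙 _ := by
          rw [whisker_exchange]; monoidal
      _ = _ := by rw [zigzag_ev_coev]; monoidal
  set e := dualTensorIso (dual V) V with he
  have h1 := capR_naturality (ev V)
  have h2 := capR_tensor (dual V) V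
  rw [dualMap_ev_eq, ← he, MonoidalCategory.whiskerLeft_comp, MonoidalCategory.whiskerLeft_comp,
    Category.assoc, Category.assoc, h2] at h1
  have h3 := (dual V ⊗ V) ◁ (dualUnitIso C).inv ≫= h1
  rw [← MonoidalCategory.whiskerLeft_comp_assoc, Iso.inv_hom_id, MonoidalCategory.whiskerLeft_id,
    Category.id_comp, whisker_exchange_assoc, capR_unit] at h3
  calc dual V ◁ (j V).hom ≫ capR (dual V)
      = 𝟙 _ ⊗≫ dual V ◁ (𝟙 (V ⊗ 𝟙_ C) ⊗≫ (j V).hom ⊗≫ 𝟙 (𝟙_ C ⊗ dual (dual V))) ⊗≫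
          capR (dual V) := by monoidal
    _ = (ρ_ _).inv ≫ (dual V ⊗ V) ◁ coev (dual V) ≫
          (𝟙 _ ⊗≫ dual V ◁ (capR V ▷ dual (dual V)) ⊗≫ capR (dual V)) := by
        rw [← hz]; monoidal
    _ = _ := by rw [← h3]; monoidal

lemma rightTrace_eq {V : C} (f : V ⟶ V) : rightTrace f = coev V ≫ f ▷ dual V ≫ capR V := rfl

lemma leftTrace_eq {V : C} (f : V ⟶ V) : leftTrace f = cupL V ≫ dual V ◁ f ≫ ev V := by
  simp only [leftTrace, cupL, Category.assoc]

lemma leftTrace_id_eq_rightTrace_dual (V : C) :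
    leftTrace (𝟙 V) = rightTrace (𝟙 (dual V)) := by
  have h : capR (dual V) = dual V ◁ (j V).inv ≫ ev V := by
    rw [← j_comp_capR_dual, ← MonoidalCategory.whiskerLeft_comp_assoc, Iso.inv_hom_id]; simp
  rw [rightTrace_eq, leftTrace_eq, h, cupL]
  simp

/-- The partial trace of a morphism over a tensor factor on the right. -/
def ptr {A B : C} (V : C) (f : A ⊗ V ⟶ B ⊗ V) : A ⟶ B :=
  𝟙 _ ⊗≫ A ◁ coev V ⊗≫ f ▷ dual V ⊗≫ B ◁ capR V ⊗≫ 𝟙 _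

/-- The partial trace of a morphism over a tensor factor on the left. -/
def ptrLeft {A B : C} (V : C) (f : V ⊗ A ⟶ V ⊗ B) : A ⟶ B :=
  𝟙 _ ⊗≫ cupL V ▷ A ⊗≫ dual V ◁ f ⊗≫ ev V ▷ B ⊗≫ 𝟙 _

lemma rightTrace_eq_ptr {V : C} (f : V ⟶ V) : rightTrace f = ptr V ((𝟙_ C) ◁ f) := by
  rw [rightTrace_eq, ptr]; monoidal

lemma whiskerRight_comp_ptr {A A' B V : C} (a : A' ⟶ A) (f : A ⊗ V ⟶ B ⊗ V) :
    ptr V (a ▷ V ≫ f) = a ≫ ptr V f := by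
  calc ptr V (a ▷ V ≫ f) = 𝟙 _ ⊗≫ (A' ◁ coev V ≫ a ▷ (V ⊗ dual V)) ⊗≫ f ▷ dual V ⊗≫
        B ◁ capR V ⊗≫ 𝟙 _ := by rw [ptr]; monoidal
    _ = _ := by rw [whisker_exchange, ptr]; monoidal

lemma ptr_comp_whiskerRight {A B B' V : C} (f : A ⊗ V ⟶ B ⊗ V) (b : B ⟶ B') :
    ptr V (f ≫ b ▷ V) = ptr V f ≫ b := by
  calc ptr V (f ≫ b ▷ V) = 𝟙 _ ⊗≫ A ◁ coev V ⊗≫ f ▷ dual V ⊗≫ (b ▷ (V ⊗ dual V) ≫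
        B' ◁ capR V) ⊗≫ 𝟙 _ := by rw [ptr]; monoidal
    _ = _ := by rw [← whisker_exchange, ptr]; monoidal

lemma ptr_whiskerLeft {A B V : C} (Z : C) (f : A ⊗ V ⟶ B ⊗ V) :
    ptr V ((α_ Z A V).hom ≫ Z ◁ f ≫ (α_ Z B V).inv) = Z ◁ ptr V f := by
  rw [ptr, ptr]; monoidal

lemma ptr_tensor {A B : C} (V W : C) (f : A ⊗ (V ⊗ W) ⟶ B ⊗ (V ⊗ W)) :
    ptr (V ⊗ W) f = ptr V (ptr W ((α_ A V W).hom ≫ f ≫ (α_ B V W).inv)) := by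
  set e := dualTensorIso V W
  have h1 : coev (V ⊗ W) = (coev V ⊗≫ (V ◁ coev W) ▷ dual V ⊗≫ 𝟙 _) ≫ (V ⊗ W) ◁ e.inv := by
    rw [← coev_tensor, Category.assoc, ← MonoidalCategory.whiskerLeft_comp, Iso.hom_inv_id]; simp
  calc ptr (V ⊗ W) f
      = 𝟙 _ ⊗≫ A ◁ (coev V ⊗≫ (V ◁ coev W) ▷ dual V ⊗≫
          𝟙 ((V ⊗ W) ⊗ (dual W ⊗ dual V))) ⊗≫
          ((A ⊗ (V ⊗ W)) ◁ e.inv ≫ f ▷ dual (V ⊗ W)) ⊗≫ B ◁ capR (V ⊗ W) ⊗≫ 𝟙 _ := by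
        rw [ptr, h1]; monoidal
    _ = 𝟙 _ ⊗≫ A ◁ (coev V ⊗≫ (V ◁ coev W) ▷ dual V ⊗≫
          𝟙 ((V ⊗ W) ⊗ (dual W ⊗ dual V))) ⊗≫ f ▷ (dual W ⊗ dual V) ⊗≫
          B ◁ ((V ⊗ W) ◁ e.inv ≫ capR (V ⊗ W)) ⊗≫ 𝟙 _ := by
        rw [whisker_exchange]; monoidal
    _ = _ := by rw [capR_tensor]; simp only [ptr]; monoidal

lemma ptr_slide {A B V W : C} (f : A ⊗ V ⟶ B ⊗ W) (g : W ⟶ V) :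
    ptr V (f ≫ B ◁ g) = ptr W (A ◁ g ≫ f) := by
  calc ptr V (f ≫ B ◁ g)
      = 𝟙 _ ⊗≫ A ◁ coev V ⊗≫ f ▷ dual V ⊗≫ B ◁ (g ▷ dual V ≫ capR V) ⊗≫ 𝟙 _ := by
        rw [ptr]; monoidal
    _ = 𝟙 _ ⊗≫ A ◁ coev V ⊗≫ (f ▷ dual V ≫ (B ⊗ W) ◁ dualMap g) ⊗≫ B ◁ capR W ⊗≫ 𝟙 _ := by
        rw [capR_naturality]; monoidal
    _ = 𝟙 _ ⊗≫ A ◁ (coev V ≫ V ◁ dualMap g) ⊗≫ f ▷ dual W ⊗≫ B ◁ capR W ⊗≫ 𝟙 _ := by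
        rw [← whisker_exchange]; monoidal
    _ = _ := by rw [coev_dualMap, ptr]; monoidal

lemma ptr_unit {A B : C} (f : A ⟶ B) : ptr (𝟙_ C) (f ▷ 𝟙_ C) = f := by
  calc ptr (𝟙_ C) (f ▷ 𝟙_ C) = 𝟙 _ ⊗≫ f ⊗≫ B ◁ (coev (𝟙_ C) ≫ capR (𝟙_ C)) ⊗≫ 𝟙 _ := by
        rw [← Category.comp_id (f ▷ 𝟙_ C), whiskerRight_comp_ptr, ptr]; monoidal
    _ = _ := by rw [coev_comp_capR_unit]; monoidal

lemma rightTrace_tensor {V W : C} (f : V ⊗ W ⟶ V ⊗ W) : rightTrace f = rightTrace (ptr W f) := by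
  rw [rightTrace_eq_ptr, ptr_tensor, rightTrace_eq_ptr, ← ptr_whiskerLeft]

lemma rightTrace_comm {V W : C} (f : V ⟶ W) (g : W ⟶ V) :
    rightTrace (f ≫ g) = rightTrace (g ≫ f) := by
  rw [rightTrace_eq_ptr, rightTrace_eq_ptr, MonoidalCategory.whiskerLeft_comp,
    MonoidalCategory.whiskerLeft_comp, ptr_slide]

lemma rightTrace_unit (f : 𝟙_ C ⟶ 𝟙_ C) : rightTrace f = f := by
  have h : 𝟙_ C ◁ f = f ▷ 𝟙_ C := by simp [unitors_equal, unitors_inv_equal]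
  rw [rightTrace_eq_ptr, h, ptr_unit]

lemma leftTrace_tensor {V W : C} (f : V ⊗ W ⟶ V ⊗ W) : leftTrace f = leftTrace (ptrLeft V f) := by
  set e := dualTensorIso V W
  have h1 : ev (V ⊗ W) = e.hom ▷ (V ⊗ W) ≫ (𝟙 _ ⊗≫ dual W ◁ (ev V ▷ W) ⊗≫ ev W) :=
    (ev_tensor V W).symm
  calc leftTrace f
      = cupL (V ⊗ W) ≫ (dual (V ⊗ W) ◁ f ≫ e.hom ▷ (V ⊗ W)) ≫
          (𝟙 _ ⊗≫ dual W ◁ (ev V ▷ W) ⊗≫ ev W) := by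
        rw [leftTrace_eq, h1, Category.assoc]
    _ = (cupL (V ⊗ W) ≫ e.hom ▷ (V ⊗ W)) ≫ (dual W ⊗ dual V) ◁ f ≫
          (𝟙 _ ⊗≫ dual W ◁ (ev V ▷ W) ⊗≫ ev W) := by
        rw [whisker_exchange]; simp only [Category.assoc]
    _ = _ := by rw [cupL_tensor, leftTrace_eq, ptrLeft]; monoidal

end PivotalTraces

/-! ### Rotation of morphisms and powers of endomorphisms -/

section Iterate

variable {C : Type u} [Category.{v} C]

/-- The `n`-fold composite of an endomorphism. -/
def compPow {X : C} (f : X ⟶ X) : ℕ → (X ⟶ X)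
  | 0 => 𝟙 X
  | n + 1 => compPow f n ≫ f

lemma comp_compPow {X Y : C} {f : X ⟶ X} {g : Y ⟶ Y} {h : X ⟶ Y} (w : h ≫ g = f ≫ h) (n : ℕ) :
    h ≫ compPow g n = compPow f n ≫ h := by
  induction n with
  | zero => simp [compPow]
  | succ n ih => rw [compPow, compPow, reassoc_of% ih, w, Category.assoc]

lemma compPow_comp {X : C} {f g : X ⟶ X} (w : f ≫ g = g ≫ f) (n : ℕ) :
    compPow (f ≫ g) n = compPow f n ≫ compPow g n := by
  induction n with
  | zero => simp [compPow]
  | succ n ih =>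
    rw [compPow, compPow, compPow, ih]
    have := comp_compPow w n
    simp only [Category.assoc]
    rw [reassoc_of% this]

end Iterate

section Rotation

variable {C : Type u} [Category.{v} C] [MonoidalCategory C]

lemma compPow_whiskerRight {X : C} (f : X ⟶ X) (Y : C) (n : ℕ) :
    compPow (f ▷ Y) n = compPow f n ▷ Y := by
  induction n with
  | zero => simp [compPow]
  | succ n ih => rw [compPow, compPow, ih, comp_whiskerRight]

variable [RightRigidCategory C] [PivotalCategory C]

/-- Rotating the first factor of `f : 𝟙_ C ⟶ V ⊗ W` to the end, by means of the pivotal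
structure. -/
def rotate {V W : C} (f : 𝟙_ C ⟶ V ⊗ W) : 𝟙_ C ⟶ W ⊗ V :=
  coev (dual V) ≫ dual V ◁ (PivotalCategory.j V).inv ≫
      ((ρ_ (dual V)).inv ≫ dual V ◁ f ≫ (α_ (dual V) V W).inv ≫ ev V ▷ W ≫ (λ_ W).hom) ▷ V

lemma rotate_eq {V W : C} (f : 𝟙_ C ⟶ V ⊗ W) :
    rotate f = cupL V ⊗≫ dual V ◁ f ▷ V ⊗≫ ev V ▷ (W ⊗ V) ⊗≫ 𝟙 _ := by
  rw [rotate, cupL]; monoidal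

end Rotation

/-! ### Monodromy, cyclic braid and twist -/

section BraidedPivotal

variable {C : Type u} [Category.{v} C] [MonoidalCategory C] [BraidedCategory C]

/-- A strand passes through a cup. -/
lemma whiskerLeft_comp_braiding_of_cup (V : C) {A B : C} (c : 𝟙_ C ⟶ A ⊗ B) :
    V ◁ c ⊗≫ (β_ V A).hom ▷ B ⊗≫ A ◁ (β_ V B).hom = 𝟙 _ ⊗≫ c ▷ V ⊗≫ 𝟙 _ := by
  have h := braiding_naturality_right V c
  rw [braiding_tensor_right_hom, braiding_tensorUnit_right] at h
  calc V ◁ c ⊗≫ (β_ V A).hom ▷ B ⊗≫ A ◁ (β_ V B).hom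
      = (V ◁ c ≫ (α_ V A B).inv ≫ (β_ V A).hom ▷ B ≫ (α_ A V B).hom ≫ A ◁ (β_ V B).hom ≫
          (α_ A B V).inv) ⊗≫ 𝟙 _ := by monoidal
    _ = _ := by rw [h]; monoidal

lemma whiskerLeft_comp_braiding_of_cup' (V : C) {A B : C} (c : 𝟙_ C ⟶ A ⊗ B) :
    V ◁ c ⊗≫ (β_ V A).hom ▷ B = 𝟙 _ ⊗≫ c ▷ V ⊗≫ A ◁ (β_ V B).inv ⊗≫ 𝟙 _ := by
  calc V ◁ c ⊗≫ (β_ V A).hom ▷ B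
      = (V ◁ c ⊗≫ (β_ V A).hom ▷ B ⊗≫ A ◁ (β_ V B).hom) ≫ A ◁ (β_ V B).inv ⊗≫ 𝟙 _ := by
        have : A ◁ (β_ V B).hom ≫ A ◁ (β_ V B).inv = 𝟙 _ := by simp
        calc _ = (V ◁ c ⊗≫ (β_ V A).hom ▷ B ⊗≫
                  (A ◁ (β_ V B).hom ≫ A ◁ (β_ V B).inv)) ⊗≫ 𝟙 _ := by rw [this]; monoidal
          _ = _ := by monoidal
    _ = _ := by rw [whiskerLeft_comp_braiding_of_cup]; monoidal

lemma whiskerLeft_comp_braiding_inv_of_cup (V : C) {A B : C} (c : 𝟙_ C ⟶ A ⊗ B) :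
    V ◁ c ⊗≫ (β_ A V).inv ▷ B ⊗≫ A ◁ (β_ B V).inv = 𝟙 _ ⊗≫ c ▷ V ⊗≫ 𝟙 _ := by
  have h := braiding_inv_naturality_right V c
  rw [braiding_tensor_left_inv, braiding_inv_tensorUnit_left] at h
  calc V ◁ c ⊗≫ (β_ A V).inv ▷ B ⊗≫ A ◁ (β_ B V).inv
      = (V ◁ c ≫ (α_ V A B).inv ≫ (β_ A V).inv ▷ B ≫ (α_ A V B).hom ≫ A ◁ (β_ B V).inv ≫
          (α_ A B V).inv) ⊗≫ 𝟙 _ := by monoidal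
    _ = _ := by rw [h]; monoidal

/-- The monodromy, or double braiding, of `X` and `W`. -/
def monodromy (X W : C) : X ⊗ W ⟶ X ⊗ W := (β_ X W).hom ≫ (β_ W X).hom

lemma monodromy_naturality {X X' W W' : C} (f : X ⟶ X') (g : W ⟶ W') :
    (f ⊗ₘ g) ≫ monodromy X' W' = monodromy X W ≫ (f ⊗ₘ g) := by
  simp [monodromy]

lemma monodromy_naturality_left {X X' : C} (f : X ⟶ X') (W : C) :
    f ▷ W ≫ monodromy X' W = monodromy X W ≫ f ▷ W := by
  simp [monodromy]

lemma monodromy_naturality_right (X : C) {W W' : C} (g : W ⟶ W') :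
    X ◁ g ≫ monodromy X W' = monodromy X W ≫ X ◁ g := by
  simp [monodromy]

lemma monodromy_tensor_right (X V W : C) :
    monodromy X (V ⊗ W) = (α_ X V W).inv ≫ (β_ X V).hom ▷ W ≫ (α_ V X W).hom ≫ V ◁ monodromy X W ≫
      (α_ V X W).inv ≫ (β_ V X).hom ▷ W ≫ (α_ X V W).hom := by
  simp [monodromy]

/-- The braid that moves the first of `n + 1` strands past the `n` others, as an endomorphism. -/
def cyclicBraid (V : C) (n : ℕ) : V ⊗ tensorPow V n ⟶ V ⊗ tensorPow V n :=
  (β_ V (tensorPow V n)).hom ≫ (tensorPowComm V n).hom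

lemma cyclicBraid_zero (V : C) : cyclicBraid V 0 = 𝟙 _ := by
  simp [cyclicBraid, tensorPow, tensorPowComm]

lemma cyclicBraid_succ (V : C) (n : ℕ) :
    cyclicBraid V (n + 1) =
      (α_ V V (tensorPow V n)).inv ≫ (β_ V V).hom ▷ tensorPow V n ≫ (α_ V V (tensorPow V n)).hom ≫
        V ◁ cyclicBraid V n := by
  simp [cyclicBraid, tensorPow, tensorPowComm]

variable [RightRigidCategory C]

/-- The Drinfeld morphism relates the evaluation of `dual V` to that of `V` through the braiding. -/
lemma drinfeldHom_comp_ev (V : C) :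
    drinfeldHom V ▷ dual V ≫ ev (dual V) = (β_ V (dual V)).hom ≫ ev V := by
  have h : drinfeldHom V = 𝟙 _ ⊗≫ V ◁ coev (dual V) ⊗≫ (β_ V (dual V)).hom ▷ dual (dual V) ⊗≫
      ev V ▷ dual (dual V) ⊗≫ 𝟙 _ := by
    calc drinfeldHom V = 𝟙 _ ⊗≫ (𝟙 (V ⊗ 𝟙_ C) ⊗≫ coev (dual V) ▷ V ⊗≫
            dual V ◁ (β_ V (dual (dual V))).inv ⊗≫ 𝟙 ((dual V ⊗ V) ⊗ dual (dual V))) ⊗≫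
            ev V ▷ dual (dual V) ⊗≫ 𝟙 _ := by rw [drinfeldHom]; monoidal
      _ = _ := by rw [← whiskerLeft_comp_braiding_of_cup']; monoidal
  calc drinfeldHom V ▷ dual V ≫ ev (dual V)
      = 𝟙 _ ⊗≫ V ◁ coev (dual V) ▷ dual V ⊗≫ ((β_ V (dual V)).hom ≫ ev V) ▷
          (dual (dual V) ⊗ dual V) ⊗≫ (𝟙_ C) ◁ ev (dual V) ⊗≫ 𝟙 _ := by rw [h]; monoidal
    _ = 𝟙 _ ⊗≫ V ◁ coev (dual V) ▷ dual V ⊗≫ (((β_ V (dual V)).hom ≫ ev V) ▷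
          (dual (dual V) ⊗ dual V) ≫ (𝟙_ C) ◁ ev (dual V)) ⊗≫ 𝟙 _ := by monoidal
    _ = 𝟙 _ ⊗≫ V ◁ (coev (dual V) ▷ dual V ⊗≫ dual V ◁ ev (dual V)) ⊗≫
          ((β_ V (dual V)).hom ≫ ev V) ⊗≫ 𝟙 _ := by rw [← whisker_exchange]; monoidal
    _ = _ := by rw [zigzag_coev_ev]; monoidal

variable [PivotalCategory C]

/-- The component `θ_V` of the twist. -/
def tw (V : C) : V ≅ V := PivotalCategory.j V ≪≫ (asIso (drinfeldHom V)).symm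

lemma tw_naturality {V W : C} (f : V ⟶ W) : f ≫ (tw W).hom = (tw V).hom ≫ f :=
  (twist C).hom.naturality f

lemma tw_hom_comp_drinfeldHom (V : C) :
    (tw V).hom ≫ drinfeldHom V = (PivotalCategory.j V).hom := by
  simp [tw]

lemma drinfeldHom_comp_j_inv (V : C) :
    drinfeldHom V ≫ (PivotalCategory.j V).inv = (tw V).inv := by
  simp [tw]

lemma capR_eq (V : C) : capR V = (β_ V (dual V)).hom ≫ dual V ◁ (tw V).hom ≫ ev V := by
  rw [capR, ← tw_hom_comp_drinfeldHom, comp_whiskerRight, Category.assoc, drinfeldHom_comp_ev,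
    braiding_naturality_left_assoc]

/-- A positive curl on the right is the twist. -/
lemma ptr_braiding (V : C) : ptr V (β_ V V).hom = (tw V).hom := by
  have h : V ◁ (β_ V (dual V)).inv ≫ V ◁ capR V = V ◁ (dual V ◁ (tw V).hom ≫ ev V) := by
    rw [← MonoidalCategory.whiskerLeft_comp, capR_eq, Iso.inv_hom_id_assoc]
  calc ptr V (β_ V V).hom
      = 𝟙 _ ⊗≫ (V ◁ coev V ⊗≫ (β_ V V).hom ▷ dual V) ⊗≫ V ◁ capR V ⊗≫ 𝟙 _ := by
        rw [ptr]; monoidal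
    _ = 𝟙 _ ⊗≫ coev V ▷ V ⊗≫ (V ◁ (β_ V (dual V)).inv ≫ V ◁ capR V) ⊗≫ 𝟙 _ := by
        rw [whiskerLeft_comp_braiding_of_cup']; monoidal
    _ = 𝟙 _ ⊗≫ (coev V ▷ V ≫ (V ⊗ dual V) ◁ (tw V).hom) ⊗≫ V ◁ ev V ⊗≫ 𝟙 _ := by
        rw [h]; monoidal
    _ = 𝟙 _ ⊗≫ (tw V).hom ⊗≫ (coev V ▷ V ⊗≫ V ◁ ev V) ⊗≫ 𝟙 _ := by
        rw [← whisker_exchange]; monoidal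
    _ = _ := by rw [zigzag_coev_ev]; monoidal

/-- A negative curl on the left is the inverse of the twist. -/
lemma ptrLeft_braiding_inv (V : C) : ptrLeft V (β_ V V).inv = (tw V).inv := by
  have h : dual V ◁ ((PivotalCategory.j V).inv ▷ V ≫ (β_ V V).inv) =
      dual V ◁ ((β_ V (dual (dual V))).inv ≫ V ◁ (PivotalCategory.j V).inv) := by
    rw [braiding_inv_naturality_left]
  calc ptrLeft V (β_ V V).inv
      = 𝟙 _ ⊗≫ coev (dual V) ▷ V ⊗≫ dual V ◁ ((PivotalCategory.j V).inv ▷ V ≫ (β_ V V).inv) ⊗≫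
          ev V ▷ V ⊗≫ 𝟙 _ := by rw [ptrLeft, cupL]; monoidal
    _ = 𝟙 _ ⊗≫ coev (dual V) ▷ V ⊗≫ dual V ◁ (β_ V (dual (dual V))).inv ⊗≫
          ((dual V ⊗ V) ◁ (PivotalCategory.j V).inv ≫ ev V ▷ V) ⊗≫ 𝟙 _ := by
        rw [h]; monoidal
    _ = drinfeldHom V ≫ (PivotalCategory.j V).inv := by
        rw [whisker_exchange, drinfeldHom]; monoidal
    _ = _ := drinfeldHom_comp_j_inv V

/-- The balancing axiom: closing up one strand after the other, each curl becomes a twist and the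
two mixed crossings are left over. -/
lemma tw_tensor (V W : C) :
    (tw (V ⊗ W)).hom = monodromy V W ≫ ((tw V).hom ⊗ₘ (tw W).hom) := by
  have h1 : ptr W ((β_ (V ⊗ W) W).hom ≫ (α_ W V W).inv) = V ◁ (tw W).hom ≫ (β_ V W).hom := by
    rw [← ptr_braiding W, ← ptr_whiskerLeft, ← ptr_comp_whiskerRight, braiding_tensor_left_hom]
    simp
  have h2 : ptr W ((α_ (V ⊗ W) V W).hom ≫ (β_ (V ⊗ W) (V ⊗ W)).hom ≫ (α_ (V ⊗ W) V W).inv) =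
      (β_ (V ⊗ W) V).hom ≫ V ◁ (V ◁ (tw W).hom ≫ (β_ V W).hom) ≫ (α_ V W V).inv := by
    rw [← h1, ← ptr_whiskerLeft, ← ptr_comp_whiskerRight, ← whiskerRight_comp_ptr,
      braiding_tensor_right_hom (V ⊗ W) V W]
    congr 1
    monoidal
  have h3 : (β_ (V ⊗ W) V).hom ≫ V ◁ (V ◁ (tw W).hom ≫ (β_ V W).hom) ≫ (α_ V W V).inv =
      (V ◁ (tw W).hom ≫ (β_ V W).hom) ▷ V ≫
        ((α_ W V V).hom ≫ W ◁ (β_ V V).hom ≫ (α_ W V V).inv) ≫ (β_ W V).hom ▷ V := by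
    rw [← braiding_naturality_left_assoc, braiding_tensor_left_hom]
    simp
  rw [← ptr_braiding, ptr_tensor, h2, h3, whiskerRight_comp_ptr, ptr_comp_whiskerRight,
    ptr_whiskerLeft, ptr_braiding, ← monodromy_naturality, tensorHom_def', monodromy]
  simp

lemma tw_unit : (tw (𝟙_ C)).hom = 𝟙 _ := by
  rw [← ptr_braiding]
  have : (β_ (𝟙_ C) (𝟙_ C)).hom = 𝟙 (𝟙_ C) ▷ 𝟙_ C := by
    simp [← unitors_inv_equal]
  rw [this, ptr_unit]

/-! ### Rotation by means of the braiding, and loops -/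

/-- Passing the bent strand over `f` by naturality leaves a positive curl. -/
lemma rotate_eq_braiding {V W : C} (f : 𝟙_ C ⟶ V ⊗ W) :
    rotate f = f ≫ ptrLeft V (β_ V V).hom ▷ W ≫ (β_ V W).hom := by
  rw [rotate_eq]
  calc cupL V ⊗≫ dual V ◁ f ▷ V ⊗≫ ev V ▷ (W ⊗ V) ⊗≫ 𝟙 _
      = cupL V ⊗≫ dual V ◁ (𝟙 (𝟙_ C ⊗ V) ⊗≫ f ▷ V ⊗≫ 𝟙 (V ⊗ W ⊗ V)) ⊗≫ ev V ▷ (W ⊗ V) ⊗≫ 𝟙 _ := by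
        monoidal
    _ = cupL V ⊗≫ dual V ◁ (𝟙 (𝟙_ C ⊗ V) ⊗≫ (V ◁ f ⊗≫ (β_ V V).hom ▷ W ⊗≫ V ◁ (β_ V W).hom) ⊗≫
          𝟙 (V ⊗ W ⊗ V)) ⊗≫ ev V ▷ (W ⊗ V) ⊗≫ 𝟙 _ := by
        rw [whiskerLeft_comp_braiding_of_cup]; monoidal
    _ = 𝟙 _ ⊗≫ (cupL V ▷ 𝟙_ C ≫ (dual V ⊗ V) ◁ f) ⊗≫ dual V ◁ (β_ V V).hom ▷ W ⊗≫
          ((dual V ⊗ V) ◁ (β_ V W).hom ≫ ev V ▷ (W ⊗ V)) ⊗≫ 𝟙 _ := by monoidal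
    _ = _ := by
        rw [← whisker_exchange (cupL V) f, whisker_exchange (ev V) (β_ V W).hom, ptrLeft]; monoidal

/-- With the inverse braiding, rotation leaves a negative curl, which is the inverse twist. -/
lemma rotate_eq_braiding_inv {V W : C} (f : 𝟙_ C ⟶ V ⊗ W) :
    rotate f = f ≫ (tw V).inv ▷ W ≫ (β_ W V).inv := by
  rw [rotate_eq, ← ptrLeft_braiding_inv]
  calc cupL V ⊗≫ dual V ◁ f ▷ V ⊗≫ ev V ▷ (W ⊗ V) ⊗≫ 𝟙 _
      = cupL V ⊗≫ dual V ◁ (𝟙 (𝟙_ C ⊗ V) ⊗≫ f ▷ V ⊗≫ 𝟙 (V ⊗ W ⊗ V)) ⊗≫ ev V ▷ (W ⊗ V) ⊗≫ 𝟙 _ := by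
        monoidal
    _ = cupL V ⊗≫ dual V ◁ (𝟙 (𝟙_ C ⊗ V) ⊗≫ (V ◁ f ⊗≫ (β_ V V).inv ▷ W ⊗≫ V ◁ (β_ W V).inv) ⊗≫
          𝟙 (V ⊗ W ⊗ V)) ⊗≫ ev V ▷ (W ⊗ V) ⊗≫ 𝟙 _ := by
        rw [whiskerLeft_comp_braiding_inv_of_cup]; monoidal
    _ = 𝟙 _ ⊗≫ (cupL V ▷ 𝟙_ C ≫ (dual V ⊗ V) ◁ f) ⊗≫ dual V ◁ (β_ V V).inv ▷ W ⊗≫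
          ((dual V ⊗ V) ◁ (β_ W V).inv ≫ ev V ▷ (W ⊗ V)) ⊗≫ 𝟙 _ := by monoidal
    _ = _ := by
        rw [← whisker_exchange (cupL V) f, whisker_exchange (ev V) (β_ W V).inv, ptrLeft]; monoidal

/-- Sliding a morphism around a strand closed up on the left. -/
lemma ptrLeft_slide {A B V W : C} (f : V ⊗ A ⟶ W ⊗ B) (g : W ⟶ V) :
    ptrLeft V (f ≫ g ▷ B) = ptrLeft W (g ▷ A ≫ f) := by
  calc ptrLeft V (f ≫ g ▷ B)
      = 𝟙 _ ⊗≫ cupL V ▷ A ⊗≫ dual V ◁ f ⊗≫ (dual V ◁ g ≫ ev V) ▷ B ⊗≫ 𝟙 _ := by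
        rw [ptrLeft]; monoidal
    _ = 𝟙 _ ⊗≫ cupL V ▷ A ⊗≫ (dual V ◁ f ≫ dualMap g ▷ (W ⊗ B)) ⊗≫ ev W ▷ B ⊗≫ 𝟙 _ := by
        rw [← dualMap_ev]; monoidal
    _ = 𝟙 _ ⊗≫ (cupL V ≫ dualMap g ▷ V) ▷ A ⊗≫ dual W ◁ f ⊗≫ ev W ▷ B ⊗≫ 𝟙 _ := by
        rw [whisker_exchange]; monoidal
    _ = _ := by rw [cupL_naturality, ptrLeft]; monoidal

lemma whiskerLeft_comp_ptrLeft {A A' B V : C} (a : A' ⟶ A) (f : V ⊗ A ⟶ V ⊗ B) :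
    ptrLeft V (V ◁ a ≫ f) = a ≫ ptrLeft V f := by
  calc ptrLeft V (V ◁ a ≫ f) = 𝟙 _ ⊗≫ (cupL V ▷ A' ≫ (dual V ⊗ V) ◁ a) ⊗≫ dual V ◁ f ⊗≫
        ev V ▷ B ⊗≫ 𝟙 _ := by rw [ptrLeft]; monoidal
    _ = _ := by rw [← whisker_exchange, ptrLeft]; monoidal

lemma ptrLeft_comp_whiskerLeft {A B B' V : C} (f : V ⊗ A ⟶ V ⊗ B) (b : B ⟶ B') :
    ptrLeft V (f ≫ V ◁ b) = ptrLeft V f ≫ b := by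
  calc ptrLeft V (f ≫ V ◁ b) = 𝟙 _ ⊗≫ cupL V ▷ A ⊗≫ dual V ◁ f ⊗≫ ((dual V ⊗ V) ◁ b ≫
        ev V ▷ B') ⊗≫ 𝟙 _ := by rw [ptrLeft]; monoidal
    _ = _ := by rw [whisker_exchange, ptrLeft]; monoidal

lemma ptrLeft_braiding_naturality {V W : C} (f : V ⟶ W) :
    f ≫ ptrLeft W (β_ W W).hom = ptrLeft V (β_ V V).hom ≫ f := by
  rw [← whiskerLeft_comp_ptrLeft, braiding_naturality_right, ptrLeft_slide,
    braiding_naturality_left, ptrLeft_comp_whiskerLeft]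

/-- The endomorphism of `X` given by a closed loop coloured by `W` around the strand `X`; in `X`
it is an endomorphism of the identity functor. -/
def encircle (W X : C) : X ⟶ X := ptr W (monodromy X W)

lemma encircle_naturality (W : C) {X Y : C} (f : X ⟶ Y) : f ≫ encircle W Y = encircle W X ≫ f := by
  rw [encircle, encircle, ← whiskerRight_comp_ptr, ← ptr_comp_whiskerRight,
    monodromy_naturality_left]

lemma encircle_tensor (W W' X : C) : encircle (W ⊗ W') X = encircle W X ≫ encircle W' X := by
  have h : (α_ X W W').hom ≫ monodromy X (W ⊗ W') ≫ (α_ X W W').inv =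
      (β_ X W).hom ▷ W' ≫ ((α_ W X W').hom ≫ W ◁ monodromy X W' ≫ (α_ W X W').inv) ≫
        (β_ W X).hom ▷ W' := by
    rw [monodromy_tensor_right]; simp
  rw [encircle, ptr_tensor, h, whiskerRight_comp_ptr, ptr_comp_whiskerRight, ptr_whiskerLeft]
  change ptr W ((β_ X W).hom ≫ W ◁ encircle W' X ≫ _) = _
  rw [braiding_naturality_right, ← Category.assoc, ptr_comp_whiskerRight]
  rfl

lemma encircle_unit (W : C) : encircle W (𝟙_ C) = rightTrace (𝟙 W) := by
  rw [rightTrace_eq_ptr, encircle, monodromy]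
  congr 1
  simp

/-- Sliding a morphism around the closed strand `W`. -/
lemma ptr_monodromy_slide {X W W' : C} (p : W ⟶ W') (i : W' ⟶ W) :
    ptr W (X ◁ (p ≫ i) ≫ monodromy X W) = ptr W' (X ◁ (i ≫ p) ≫ monodromy X W') := by
  rw [MonoidalCategory.whiskerLeft_comp, Category.assoc, monodromy_naturality_right,
    ← Category.assoc, ptr_slide, MonoidalCategory.whiskerLeft_comp, Category.assoc]

/-! ### The cyclic braid -/

/-- The full winding of the strand `V` around `W`, framed by a twist of `V`. -/
def fullTwist (W V : C) : W ⊗ V ⟶ W ⊗ V := monodromy W V ≫ W ◁ (tw V).hom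

/-- The balancing axiom in terms of the full winding. -/
lemma fullTwist_eq (W V : C) : fullTwist W V = (tw (W ⊗ V)).hom ≫ (tw W).inv ▷ V := by
  rw [tw_tensor, fullTwist, MonoidalCategory.tensorHom_def, Category.assoc, Category.assoc,
    whisker_exchange, ← comp_whiskerRight_assoc, Iso.hom_inv_id]
  simp

lemma compPow_fullTwist (W V : C) (n : ℕ) :
    compPow (fullTwist W V) n = compPow (tw (W ⊗ V)).hom n ≫ compPow (tw W).inv n ▷ V := by
  rw [fullTwist_eq, compPow_comp (tw_naturality _).symm, compPow_whiskerRight]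

/-- The partial closure of an endomorphism `c` of `V ⊗ P` encircled by `W`: the factor `P` is
closed up, and the strands `W` and `V` are kept. -/
def encircledClosure (W V : C) {P : C} (c : V ⊗ P ⟶ V ⊗ P) : W ⊗ V ⟶ W ⊗ V :=
  ptr P ((α_ W V P).hom ≫ W ◁ c ≫ monodromy W (V ⊗ P) ≫ (α_ W V P).inv)

lemma encircledClosure_unit (W V : C) : encircledClosure W V (𝟙 (V ⊗ 𝟙_ C)) = monodromy W V := by
  have h : (α_ W V (𝟙_ C)).hom ≫ W ◁ 𝟙 (V ⊗ 𝟙_ C) ≫ monodromy W (V ⊗ 𝟙_ C) ≫ (α_ W V (𝟙_ C)).inv =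
      monodromy W V ▷ 𝟙_ C := by
    rw [monodromy_tensor_right]
    simp [monodromy]
  rw [encircledClosure, h, ptr_unit]

/-- Adding a strand with one crossing winds the strand `V` once more around `W`: the naturality of
the braiding brings the new crossing next to the rest of the closure, and then it is a curl. -/
lemma encircledClosure_succ (W V : C) {P : C} (c : V ⊗ P ⟶ V ⊗ P) :
    encircledClosure W V ((α_ V V P).inv ≫ (β_ V V).hom ▷ P ≫ (α_ V V P).hom ≫ V ◁ c) =
      encircledClosure W V c ≫ fullTwist W V := by
  have h1 : (α_ (W ⊗ V) V P).hom ≫ ((α_ W V (V ⊗ P)).hom ≫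
      W ◁ ((α_ V V P).inv ≫ (β_ V V).hom ▷ P ≫ (α_ V V P).hom ≫ V ◁ c) ≫
      monodromy W (V ⊗ (V ⊗ P)) ≫ (α_ W V (V ⊗ P)).inv) ≫ (α_ (W ⊗ V) V P).inv =
      (β_ (W ⊗ V) V).hom ▷ P ≫ ((α_ V (W ⊗ V) P).hom ≫ V ◁ ((α_ W V P).hom ≫
        W ◁ c ≫ monodromy W (V ⊗ P) ≫ (α_ W V P).inv) ≫ (α_ V (W ⊗ V) P).inv) ≫
        ((α_ V W V).inv ≫ (β_ V W).hom ▷ V) ▷ P := by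
    rw [monodromy_tensor_right W V (V ⊗ P), braiding_tensor_left_hom]
    have h : W ◁ (V ◁ c) ≫ (α_ W V (V ⊗ P)).inv ≫ (β_ W V).hom ▷ (V ⊗ P) =
        (α_ W V (V ⊗ P)).inv ≫ (β_ W V).hom ▷ (V ⊗ P) ≫ (V ⊗ W) ◁ c := by
      rw [← whisker_exchange]; simp
    simp only [MonoidalCategory.whiskerLeft_comp, Category.assoc]
    rw [reassoc_of% h]
    monoidal
  have h2 : (β_ (W ⊗ V) V).hom ≫ V ◁ encircledClosure W V c ≫ (α_ V W V).inv ≫ (β_ V W).hom ▷ V =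
      encircledClosure W V c ▷ V ≫ ((α_ W V V).hom ≫ W ◁ (β_ V V).hom ≫ (α_ W V V).inv) ≫
        monodromy W V ▷ V := by
    rw [← braiding_naturality_left_assoc, braiding_tensor_left_hom]
    simp [monodromy]
  rw [encircledClosure, ptr_tensor, h1, whiskerRight_comp_ptr, ptr_comp_whiskerRight,
    ptr_whiskerLeft]
  change ptr V ((β_ (W ⊗ V) V).hom ≫ V ◁ encircledClosure W V c ≫ (α_ V W V).inv ≫
    (β_ V W).hom ▷ V) = _
  rw [h2, whiskerRight_comp_ptr, ptr_comp_whiskerRight, ptr_whiskerLeft, ptr_braiding,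
    monodromy_naturality_right, fullTwist]

/-- Closing up the cyclic braid around `W` winds the remaining strand `n + 1` times around `W`. -/
lemma encircledClosure_cyclicBraid_comp (W V : C) (n : ℕ) :
    encircledClosure W V (cyclicBraid V n) ≫ W ◁ (tw V).hom = compPow (fullTwist W V) (n + 1) := by
  induction n with
  | zero =>
    rw [cyclicBraid_zero]
    refine (congrArg (· ≫ W ◁ (tw V).hom) (encircledClosure_unit W V)).trans ?_
    simp [compPow, fullTwist]
  | succ n ih =>
    rw [cyclicBraid_succ, compPow, ← ih]
    refine (congrArg (· ≫ W ◁ (tw V).hom) (encircledClosure_succ W V (cyclicBraid V n))).trans ?_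
    rw [fullTwist, Category.assoc, Category.assoc, Category.assoc,
      reassoc_of% monodromy_naturality_right W (tw V).hom]

/-- The trace of `c` with a loop `W` around it, taken by closing up `P` first and then `W ⊗ V`. -/
lemma rightTrace_encircle (W V : C) {P : C} (c : V ⊗ P ⟶ V ⊗ P) :
    rightTrace (c ≫ encircle W (V ⊗ P)) = rightTrace (encircledClosure W V c) := by
  calc rightTrace (c ≫ encircle W (V ⊗ P))
      = rightTrace ((β_ W (V ⊗ P)).hom ≫ c ▷ W ≫ (β_ (V ⊗ P) W).hom) := by
        rw [encircle, ← whiskerRight_comp_ptr, ← rightTrace_tensor, monodromy, ← Category.assoc,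
          rightTrace_comm]
    _ = rightTrace ((W ◁ c ≫ monodromy W (V ⊗ P) ≫ (α_ W V P).inv) ≫ (α_ W V P).hom) := by
        rw [← braiding_naturality_right_assoc, monodromy]; simp
    _ = _ := by rw [rightTrace_comm, rightTrace_tensor, encircledClosure]

/-- The trace of the twisted cyclic braid encircled by `W`: an unknotted strand `V` winding `n + 1`
times around `W`. -/
lemma rightTrace_cyclicBraid_encircle (W V : C) (n : ℕ) :
    rightTrace (((tw V).hom ▷ tensorPow V n ≫ cyclicBraid V n) ≫ encircle W (V ⊗ tensorPow V n)) =
      rightTrace (compPow (tw (W ⊗ V)).hom (n + 1) ≫ compPow (tw W).inv (n + 1) ▷ V) := by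
  have h : encircledClosure W V ((tw V).hom ▷ tensorPow V n ≫ cyclicBraid V n) =
      W ◁ (tw V).hom ≫ encircledClosure W V (cyclicBraid V n) := by
    rw [encircledClosure, encircledClosure, ← whiskerRight_comp_ptr]
    congr 1
    simp
  rw [rightTrace_encircle, h, rightTrace_comm, encircledClosure_cyclicBraid_comp, compPow_fullTwist]

end BraidedPivotal

open Module

/-! ### Scalars, traces and dimensions -/

section Scalar

variable {C : Type u} [Category.{v} C] [Preadditive C] [Linear ℂ C]

/-- The scalar by which an endomorphism of a simple object acts.  It is defined as the trace of
composition with the endomorphism, so that it is linear without any hypothesis. -/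
def scalar (X : C) : (X ⟶ X) →ₗ[ℂ] ℂ :=
  LinearMap.trace ℂ (X ⟶ X) ∘ₗ (Linear.comp X X X).flip

lemma scalar_id {X : C} (h : finrank ℂ (X ⟶ X) = 1) : scalar X (𝟙 X) = 1 := by
  have h1 : (Linear.comp (S := ℂ) X X X).flip (𝟙 X) = LinearMap.id := by ext f; simp
  have : Module.Finite ℂ (X ⟶ X) := Module.finite_of_finrank_pos (by omega)
  rw [scalar, LinearMap.comp_apply, h1, LinearMap.trace_id, h, Nat.cast_one]

lemma eq_scalar_smul_id {X : C} (h : finrank ℂ (X ⟶ X) = 1) (f : X ⟶ X) :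
    f = scalar X f • 𝟙 X := by
  have h0 : 𝟙 X ≠ 0 := by
    intro h0
    have : Subsingleton (X ⟶ X) := ⟨fun f g => by
      rw [← Category.comp_id f, ← Category.comp_id g, h0, comp_zero, comp_zero]⟩
    rw [finrank_zero_of_subsingleton] at h
    omega
  obtain ⟨c, rfl⟩ := (finrank_eq_one_iff_of_nonzero' (𝟙 X) h0).mp h f
  rw [map_smul, scalar_id h, smul_eq_mul, mul_one]

lemma scalar_smul_id {X : C} (h : finrank ℂ (X ⟶ X) = 1) (c : ℂ) : scalar X (c • 𝟙 X) = c := by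
  rw [map_smul, scalar_id h, smul_eq_mul, mul_one]

lemma scalar_comp {X : C} (h : finrank ℂ (X ⟶ X) = 1) (f g : X ⟶ X) :
    scalar X (f ≫ g) = scalar X f * scalar X g := by
  conv_lhs => rw [eq_scalar_smul_id h f, Linear.smul_comp, Category.id_comp, map_smul, smul_eq_mul]

end Scalar

section Trace

variable {C : Type u} [Category.{v} C] [Preadditive C] [Linear ℂ C] [MonoidalCategory C]
  [MonoidalPreadditive C] [MonoidalLinear ℂ C] [RightRigidCategory C] [PivotalCategory C]

/-- The partial trace as a linear map. -/
def ptrHom (A B V : C) : (A ⊗ V ⟶ B ⊗ V) →ₗ[ℂ] (A ⟶ B) where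
  toFun f := ptr V f
  map_add' f g := by
    simp [ptr, monoidalComp, MonoidalPreadditive.add_whiskerRight]
  map_smul' c f := by simp [ptr, monoidalComp]

lemma ptrHom_apply {A B V : C} (f : A ⊗ V ⟶ B ⊗ V) : ptrHom A B V f = ptr V f := rfl

/-- The right pivotal trace as a linear map to the complex numbers. -/
def tr (V : C) : (V ⟶ V) →ₗ[ℂ] ℂ where
  toFun f := scalar (𝟙_ C) (rightTrace f)
  map_add' f g := by
    simp [rightTrace, MonoidalPreadditive.add_whiskerRight]
  map_smul' c f := by simp [rightTrace]

lemma tr_apply {V : C} (f : V ⟶ V) : tr V f = scalar (𝟙_ C) (rightTrace f) := rfl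

lemma tr_comm {V W : C} (f : V ⟶ W) (g : W ⟶ V) : tr V (f ≫ g) = tr W (g ≫ f) := by
  rw [tr_apply, tr_apply, rightTrace_comm]

lemma tr_ptr {V W : C} (f : V ⊗ W ⟶ V ⊗ W) : tr V (ptr W f) = tr (V ⊗ W) f := by
  rw [tr_apply, tr_apply, rightTrace_tensor]

/-- The pivotal dimension. -/
def dim (V : C) : ℂ := tr V (𝟙 V)

lemma dim_eq_of_iso {V W : C} (e : V ≅ W) : dim V = dim W := by
  rw [dim, dim, ← e.hom_inv_id, tr_comm, e.inv_hom_id]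

lemma dim_unit (h : finrank ℂ (𝟙_ C ⟶ 𝟙_ C) = 1) : dim (𝟙_ C) = 1 := by
  rw [dim, tr_apply, rightTrace_unit, scalar_id h]

lemma tr_whiskerRight (h : finrank ℂ (𝟙_ C ⟶ 𝟙_ C) = 1) {V : C} (f : V ⟶ V) (W : C) :
    tr (V ⊗ W) (f ▷ W) = tr V f * dim W := by
  have h1 : ptr W (𝟙 (V ⊗ W)) = dim W • 𝟙 V := by
    have h2 : ptr W (𝟙 (V ⊗ W)) = (ρ_ V).inv ≫ V ◁ rightTrace (𝟙 W) ≫ (ρ_ V).hom := by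
      rw [rightTrace_eq, ptr]; monoidal
    rw [h2, eq_scalar_smul_id h (rightTrace (𝟙 W))]
    simp [dim, tr_apply]
  rw [← tr_ptr, ← Category.comp_id (f ▷ W), whiskerRight_comp_ptr, h1]
  simp [mul_comm]

lemma dim_tensor (h : finrank ℂ (𝟙_ C ⟶ 𝟙_ C) = 1) (V W : C) : dim (V ⊗ W) = dim V * dim W := by
  rw [dim, ← id_whiskerRight, tr_whiskerRight h, ← dim]

end Trace

/-! ### Decompositions into simple objects -/

section Decomposition

variable {C : Type u} [Category.{v} C]

/-- A decomposition of `A` into a finite direct sum of members of the family `X`.  The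
orthogonality of different summands is left out, since trace computations do not need it. -/
structure Decomposition [Preadditive C] {ι : Type*} (X : ι → C) (A : C) where
  /-- The number of summands. -/
  n : ℕ
  /-- The index of each summand. -/
  s : Fin n → ι
  /-- The inclusions. -/
  i : ∀ a, X (s a) ⟶ A
  /-- The projections. -/
  p : ∀ a, A ⟶ X (s a)
  i_p_self : ∀ a, i a ≫ p a = 𝟙 _
  sum_p_i : ∑ a, p a ≫ i a = 𝟙 A

variable [Abelian C]

attribute [local instance] Abelian.hasFiniteBiproducts

variable {r : ℕ} {X : Fin r → C}

lemma subsingleton_hom (hX : IsCompleteListOfSimples X) {i k : Fin r} (h : i ≠ k) :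
    Subsingleton (X i ⟶ X k) := by
  have := hX.simple i
  have := hX.simple k
  refine subsingleton_of_forall_eq 0 fun f => ?_
  by_contra hf
  have := isIso_of_hom_simple hf
  exact h (hX.eq_of_iso _ _ ⟨asIso f⟩)

variable [Linear ℂ C] [MonoidalCategory C] [FusionCategory C]

lemma IsCompleteListOfSimples.nonempty_decomposition (hX : IsCompleteListOfSimples X) (A : C) :
    Nonempty (Decomposition X A) := by
  obtain ⟨n, Y, hY, ⟨e⟩⟩ := FusionCategory.semisimple A
  choose s hs using fun a => hX.exists_iso (Y a) (hY a)
  let t := fun a => (hs a).some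
  exact ⟨{
    n := n
    s := s
    i := fun a => (t a).inv ≫ biproduct.ι Y a ≫ e.inv
    p := fun a => e.hom ≫ biproduct.π Y a ≫ (t a).hom
    i_p_self := fun a => by simp
    sum_p_i := by
      have : ∀ a, (e.hom ≫ biproduct.π Y a ≫ (t a).hom) ≫ (t a).inv ≫ biproduct.ι Y a ≫ e.inv =
          e.hom ≫ (biproduct.π Y a ≫ biproduct.ι Y a) ≫ e.inv := by intro a; simp
      simp_rw [this]
      rw [← Preadditive.comp_sum, ← Preadditive.sum_comp, biproduct.total]
      simp }⟩

lemma finrank_end (hX : IsCompleteListOfSimples X) (i : Fin r) : finrank ℂ (X i ⟶ X i) = 1 :=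
  FusionCategory.end_simple _ (hX.simple i)

variable (C) in
lemma finrank_end_unit : finrank ℂ (𝟙_ C ⟶ 𝟙_ C) = 1 :=
  FusionCategory.end_simple _ FusionCategory.unit_simple

lemma finrank_hom (hX : IsCompleteListOfSimples X) (i k : Fin r) :
    finrank ℂ (X i ⟶ X k) = if i = k then 1 else 0 := by
  split_ifs with h
  · subst h; exact finrank_end hX i
  · have := subsingleton_hom hX h
    exact finrank_zero_of_subsingleton

lemma finite_hom_simple (hX : IsCompleteListOfSimples X) (i k : Fin r) :
    Module.Finite ℂ (X i ⟶ X k) := by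
  by_cases h : i = k
  · subst h; exact Module.finite_of_finrank_pos (by rw [finrank_end hX]; omega)
  · have := subsingleton_hom hX h
    infer_instance

instance finite_hom (A B : C) : Module.Finite ℂ (A ⟶ B) := by
  obtain ⟨r, X, hX⟩ := FusionCategory.finitely_many_simples (C := C)
  obtain ⟨D⟩ := hX.nonempty_decomposition A
  obtain ⟨E⟩ := hX.nonempty_decomposition B
  have := fun a b => finite_hom_simple hX (D.s a) (E.s b)
  let φ : (A ⟶ B) →ₗ[ℂ] (∀ a b, X (D.s a) ⟶ X (E.s b)) :=
    LinearMap.pi fun a => LinearMap.pi fun b =>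
      Linear.rightComp ℂ _ (E.p b) ∘ₗ Linear.leftComp ℂ _ (D.i a)
  refine Module.Finite.of_injective φ fun f g h => ?_
  have h1 : ∀ a b, (D.i a ≫ f) ≫ E.p b = (D.i a ≫ g) ≫ E.p b :=
    fun a b => congrFun (congrFun h a) b
  have key : ∀ f : A ⟶ B, f = ∑ a, D.p a ≫ ∑ b, ((D.i a ≫ f) ≫ E.p b) ≫ E.i b := by
    intro f
    simp only [Category.assoc, ← Preadditive.comp_sum, E.sum_p_i, Category.comp_id]
    simp only [← Category.assoc, ← Preadditive.sum_comp, D.sum_p_i, Category.id_comp]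
  rw [key f, key g]
  simp only [h1]

variable (X) in
/-- The multiplicity of the simple object `X i` in `A`. -/
def mult (A : C) (i : Fin r) : ℕ := finrank ℂ (X i ⟶ A)

lemma trace_rightComp_simple (hX : IsCompleteListOfSimples X) (i k : Fin r) (f : X k ⟶ X k) :
    LinearMap.trace ℂ (X i ⟶ X k) (Linear.rightComp ℂ (X i) f) =
      if i = k then scalar (X k) f else 0 := by
  have h : Linear.rightComp ℂ (X i) f = scalar (X k) f • LinearMap.id := by
    ext g
    conv_lhs => rw [eq_scalar_smul_id (finrank_end hX k) f]
    simp
  have := finite_hom_simple hX i k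
  rw [h, map_smul, LinearMap.trace_id, finrank_hom hX]
  split_ifs <;> simp

/-- The trace on a space of morphisms out of a simple object, in terms of a decomposition of the
target. -/
lemma trace_rightComp (hX : IsCompleteListOfSimples X) {A : C} (D : Decomposition X A)
    (i : Fin r) (f : A ⟶ A) :
    LinearMap.trace ℂ (X i ⟶ A) (Linear.rightComp ℂ (X i) f) =
      ∑ a, if i = D.s a then scalar (X (D.s a)) (D.i a ≫ f ≫ D.p a) else 0 := by
  have h : Linear.rightComp ℂ (X i) f =
      ∑ a, Linear.rightComp ℂ (X i) (D.i a) ∘ₗ Linear.rightComp ℂ (X i) (f ≫ D.p a) := by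
    ext g
    simp only [Linear.rightComp_apply, LinearMap.sum_apply, LinearMap.comp_apply, Category.assoc,
      ← Preadditive.comp_sum, D.sum_p_i, Category.comp_id]
  rw [h, map_sum]
  refine Finset.sum_congr rfl fun a _ => ?_
  rw [LinearMap.trace_comp_comm', ← trace_rightComp_simple hX]
  congr 1
  ext g
  simp

lemma mult_eq_card (hX : IsCompleteListOfSimples X) {A : C} (D : Decomposition X A) (i : Fin r) :
    mult X A i = (Finset.univ.filter fun a => i = D.s a).card := by
  have h := trace_rightComp hX D i (𝟙 A)
  have h1 : Linear.rightComp ℂ (X i) (𝟙 A) = LinearMap.id := by ext; simp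
  rw [h1, LinearMap.trace_id] at h
  simp only [Category.id_comp, D.i_p_self, scalar_id (finrank_end hX _), Finset.sum_boole] at h
  exact_mod_cast h

lemma finrank_hom_to_simple (hX : IsCompleteListOfSimples X) (A : C) (i : Fin r) :
    finrank ℂ (A ⟶ X i) = mult X A i := by
  obtain ⟨D⟩ := hX.nonempty_decomposition A
  have h : (LinearMap.id : (A ⟶ X i) →ₗ[ℂ] (A ⟶ X i)) =
      ∑ a, Linear.leftComp ℂ (X i) (D.p a) ∘ₗ Linear.leftComp ℂ (X i) (D.i a) := by
    ext g
    simp only [LinearMap.id_apply, LinearMap.sum_apply, LinearMap.comp_apply, Linear.leftComp_apply,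
      ← Category.assoc, ← Preadditive.sum_comp, D.sum_p_i, Category.id_comp]
  have h1 := congrArg (LinearMap.trace ℂ (A ⟶ X i)) h
  have h2 : ∀ a, LinearMap.trace ℂ (A ⟶ X i)
      (Linear.leftComp ℂ (X i) (D.p a) ∘ₗ Linear.leftComp ℂ (X i) (D.i a)) =
        if i = D.s a then 1 else 0 := by
    intro a
    have h3 : Linear.leftComp ℂ (X i) (D.i a) ∘ₗ Linear.leftComp ℂ (X i) (D.p a) =
        LinearMap.id := by
      ext g; simp [← Category.assoc, D.i_p_self]
    rw [LinearMap.trace_comp_comm', h3, LinearMap.trace_id, finrank_hom hX]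
    simp [eq_comm]
  rw [LinearMap.trace_id, map_sum] at h1
  simp only [h2, Finset.sum_boole] at h1
  rw [mult_eq_card hX D]
  exact_mod_cast h1

lemma sum_decomposition (hX : IsCompleteListOfSimples X) {A : C} (D : Decomposition X A)
    (g : Fin r → ℂ) : ∑ a, g (D.s a) = ∑ i, (mult X A i : ℂ) * g i := by
  simp only [mult_eq_card hX D, ← Finset.sum_boole, Finset.sum_mul]
  rw [Finset.sum_comm]
  simp

end Decomposition

/-! ### Dimensions in a fusion category -/

section Dimensions

variable {C : Type u} [Category.{v} C] [Abelian C] [Linear ℂ C] [MonoidalCategory C]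
  [MonoidalPreadditive C] [MonoidalLinear ℂ C] [RightRigidCategory C] [PivotalCategory C]
  [FusionCategory C]

variable {r : ℕ} {X : Fin r → C}

lemma tr_eq_sum (hX : IsCompleteListOfSimples X) {A : C} (D : Decomposition X A) (f : A ⟶ A) :
    tr A f = ∑ a, scalar (X (D.s a)) (D.i a ≫ f ≫ D.p a) * dim (X (D.s a)) := by
  have h : f = ∑ a, (f ≫ D.p a) ≫ D.i a := by
    simp only [Category.assoc, ← Preadditive.comp_sum, D.sum_p_i, Category.comp_id]
  conv_lhs => rw [h, map_sum]
  refine Finset.sum_congr rfl fun a _ => ?_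
  rw [tr_comm]
  conv_lhs => rw [eq_scalar_smul_id (finrank_end hX _) (D.i a ≫ f ≫ D.p a)]
  rw [map_smul, smul_eq_mul, dim]

lemma dim_eq_sum (hX : IsCompleteListOfSimples X) (A : C) :
    dim A = ∑ i, (mult X A i : ℂ) * dim (X i) := by
  obtain ⟨D⟩ := hX.nonempty_decomposition A
  rw [← sum_decomposition hX D (fun i => dim (X i)), dim, tr_eq_sum hX D]
  refine Finset.sum_congr rfl fun a _ => ?_
  rw [Category.id_comp, D.i_p_self, scalar_id (finrank_end hX _), one_mul]

/-- Frobenius reciprocity for the multiplicities. -/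
lemma mult_tensor (hX : IsCompleteListOfSimples X) (B : C) (i m : Fin r) :
    mult X (X i ⊗ B) m = mult X (X m ⊗ dual B) i := by
  let e : (X i ⊗ B ⟶ X m) ≃ₗ[ℂ] (X i ⟶ X m ⊗ dual B) :=
    { tensorRightHomEquiv (X i) B (dual B) (X m) with
      map_add' := fun f g => by
        simp [tensorRightHomEquiv, MonoidalPreadditive.add_whiskerRight]
      map_smul' := fun c f => by
        simp [tensorRightHomEquiv] }
  rw [← finrank_hom_to_simple hX, e.finrank_eq, mult]

variable [Spherical C]

lemma dim_dual (V : C) : dim (dual V) = dim V := by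
  rw [dim, dim, tr_apply, tr_apply, ← leftTrace_id_eq_rightTrace_dual,
    Spherical.leftTrace_eq_rightTrace]

/-- The vector of dimensions is an eigenvector of tensoring with `B`. -/
lemma sum_dim_mul_mult (hX : IsCompleteListOfSimples X) (B : C) (m : Fin r) :
    ∑ i, dim (X i) * mult X (X i ⊗ B) m = dim (X m) * dim B := by
  rw [← dim_dual B, ← dim_tensor (finrank_end_unit C), dim_eq_sum hX]
  refine Finset.sum_congr rfl fun i _ => ?_
  rw [mult_tensor hX, mul_comm]

lemma exists_dim_eq_one (hX : IsCompleteListOfSimples X) : ∃ i, dim (X i) = 1 := by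
  obtain ⟨i, ⟨e⟩⟩ := hX.exists_iso (𝟙_ C) FusionCategory.unit_simple
  exact ⟨i, by rw [← dim_eq_of_iso e, dim_unit (finrank_end_unit C)]⟩

open ComplexConjugate in
/-- Dimensions in a spherical fusion category are real: the dimension vector is a common eigenvector
of the non-negative integer matrix of tensoring with `X l` and of its transpose, with the same
eigenvalue. -/
lemma conj_dim (hX : IsCompleteListOfSimples X) (l : Fin r) :
    conj (dim (X l)) = dim (X l) := by
  have h1 : ∑ m, ∑ i, conj (dim (X m)) * (dim (X i) * mult X (X i ⊗ X l) m) =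
      dim (X l) * ∑ m, conj (dim (X m)) * dim (X m) := by
    rw [Finset.mul_sum]
    refine Finset.sum_congr rfl fun m _ => ?_
    rw [← Finset.mul_sum, sum_dim_mul_mult hX]
    ring
  have h2 : ∑ m, ∑ i, conj (dim (X m)) * (dim (X i) * mult X (X i ⊗ X l) m) =
      conj (dim (X l)) * ∑ m, conj (dim (X m)) * dim (X m) := by
    rw [Finset.sum_comm, Finset.mul_sum]
    refine Finset.sum_congr rfl fun i _ => ?_
    have h3 := congrArg conj (dim_tensor (finrank_end_unit C) (X i) (X l))
    rw [dim_eq_sum hX, map_sum, map_mul] at h3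
    simp only [map_mul, map_natCast] at h3
    calc ∑ m, conj (dim (X m)) * (dim (X i) * mult X (X i ⊗ X l) m)
        = dim (X i) * ∑ m, mult X (X i ⊗ X l) m * conj (dim (X m)) := by
          rw [Finset.mul_sum]; exact Finset.sum_congr rfl fun m _ => by ring
      _ = _ := by rw [h3]; ring
  have h4 : ∑ m, conj (dim (X m)) * dim (X m) ≠ 0 := by
    have h5 : ∑ m, conj (dim (X m)) * dim (X m) = ((∑ m, Complex.normSq (dim (X m)) : ℝ) : ℂ) := by
      simp only [Complex.ofReal_sum, Complex.normSq_eq_conj_mul_self]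
    obtain ⟨i, hi⟩ := exists_dim_eq_one hX
    rw [h5, Complex.ofReal_ne_zero]
    refine (Finset.sum_pos' (fun m _ => Complex.normSq_nonneg _) ⟨i, Finset.mem_univ _, ?_⟩).ne'
    rw [hi]; simp
  exact (mul_right_cancel₀ h4 (h1.symm.trans h2)).symm

/-- The sum of the squares of the dimensions of the simple objects. -/
def globalDim (X : Fin r → C) : ℂ := ∑ i, dim (X i) ^ 2

lemma dim_eq_ofReal (hX : IsCompleteListOfSimples X) (i : Fin r) :
    dim (X i) = ((dim (X i)).re : ℂ) :=
  (Complex.conj_eq_iff_re.mp (conj_dim hX i)).symm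

lemma globalDim_ne_zero (hX : IsCompleteListOfSimples X) : globalDim X ≠ 0 := by
  have h : globalDim X = ((∑ i, (dim (X i)).re ^ 2 : ℝ) : ℂ) := by
    rw [globalDim, Complex.ofReal_sum]
    refine Finset.sum_congr rfl fun i _ => ?_
    conv_lhs => rw [dim_eq_ofReal hX i]
    push_cast; rfl
  obtain ⟨i, hi⟩ := exists_dim_eq_one hX
  rw [h, Complex.ofReal_ne_zero]
  refine (Finset.sum_pos' (fun m _ => sq_nonneg _) ⟨i, Finset.mem_univ _, ?_⟩).ne'
  rw [hi]; simp

end Dimensions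

/-! ### Twists and loops on simple objects -/

section Braided

variable {C : Type u} [Category.{v} C] [Abelian C] [Linear ℂ C] [MonoidalCategory C]
  [MonoidalPreadditive C] [MonoidalLinear ℂ C] [RightRigidCategory C] [BraidedCategory C]
  [PivotalCategory C] [FusionCategory C]

variable {r : ℕ} {X : Fin r → C}

/-- The scalar by which the twist acts on a simple object. -/
def theta (V : C) : ℂ := scalar V (tw V).hom

/-- The scalar by which a loop coloured by `W` acts on a simple object `V`. -/
def encircleScalar (W V : C) : ℂ := scalar V (encircle W V)

lemma compPow_smul_id {V : C} (c : ℂ) (n : ℕ) : compPow (c • 𝟙 V) n = c ^ n • 𝟙 V := by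
  induction n with
  | zero => simp [compPow]
  | succ n ih => simp [compPow, ih, smul_smul, pow_succ, mul_comm]

lemma tw_hom_eq (hX : IsCompleteListOfSimples X) (i : Fin r) :
    (tw (X i)).hom = theta (X i) • 𝟙 (X i) := eq_scalar_smul_id (finrank_end hX i) _

lemma theta_mul_scalar_inv (hX : IsCompleteListOfSimples X) (i : Fin r) :
    theta (X i) * scalar (X i) (tw (X i)).inv = 1 := by
  rw [theta, ← scalar_comp (finrank_end hX i), Iso.hom_inv_id, scalar_id (finrank_end hX i)]

lemma theta_ne_zero (hX : IsCompleteListOfSimples X) (i : Fin r) : theta (X i) ≠ 0 :=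
  left_ne_zero_of_mul_eq_one (theta_mul_scalar_inv hX i)

lemma tw_inv_eq (hX : IsCompleteListOfSimples X) (i : Fin r) :
    (tw (X i)).inv = (theta (X i))⁻¹ • 𝟙 (X i) := by
  rw [← eq_inv_of_mul_eq_one_right (theta_mul_scalar_inv hX i)]
  exact eq_scalar_smul_id (finrank_end hX i) _

lemma tr_compPow_tw (hX : IsCompleteListOfSimples X) (A : C) (n : ℕ) :
    tr A (compPow (tw A).hom n) = ∑ i, (mult X A i : ℂ) * (theta (X i) ^ n * dim (X i)) := by
  obtain ⟨D⟩ := hX.nonempty_decomposition A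
  rw [← sum_decomposition hX D (fun i => theta (X i) ^ n * dim (X i)), tr_eq_sum hX D]
  refine Finset.sum_congr rfl fun a _ => ?_
  rw [← Category.assoc, comp_compPow (tw_naturality (D.i a)), Category.assoc, D.i_p_self,
    Category.comp_id, tw_hom_eq hX, compPow_smul_id, scalar_smul_id (finrank_end hX _)]

lemma tr_comp_encircle (hX : IsCompleteListOfSimples X) {A : C} (D : Decomposition X A) (f : A ⟶ A)
    (W : C) : tr A (f ≫ encircle W A) = ∑ a, scalar (X (D.s a)) (D.i a ≫ f ≫ D.p a) *
      (encircleScalar W (X (D.s a)) * dim (X (D.s a))) := by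
  rw [tr_eq_sum hX D]
  refine Finset.sum_congr rfl fun a _ => ?_
  have h : D.i a ≫ (f ≫ encircle W A) ≫ D.p a = (D.i a ≫ f ≫ D.p a) ≫ encircle W (X (D.s a)) := by
    simp only [Category.assoc]
    rw [encircle_naturality]
  rw [h, scalar_comp (finrank_end hX _), mul_assoc, encircleScalar]

lemma encircle_eq_sum {A : C} (D : Decomposition X A) (V : C) :
    encircle A V = ∑ a, encircle (X (D.s a)) V := by
  have h : monodromy V A = ∑ a, V ◁ (D.p a ≫ D.i a) ≫ monodromy V A := by
    rw [← Preadditive.sum_comp, ← whiskerLeft_sum, D.sum_p_i]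
    simp
  rw [encircle, ← ptrHom_apply, h, map_sum]
  refine Finset.sum_congr rfl fun a _ => ?_
  rw [ptrHom_apply, ptr_monodromy_slide, D.i_p_self, encircle]
  simp

lemma encircleScalar_eq_sum (hX : IsCompleteListOfSimples X) (A V : C) :
    encircleScalar A V = ∑ i, (mult X A i : ℂ) * encircleScalar (X i) V := by
  obtain ⟨D⟩ := hX.nonempty_decomposition A
  rw [← sum_decomposition hX D (fun i => encircleScalar (X i) V), encircleScalar,
    encircle_eq_sum D, map_sum]
  rfl

lemma encircleScalar_tensor (hX : IsCompleteListOfSimples X) (W W' : C) (j : Fin r) :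
    encircleScalar (W ⊗ W') (X j) = encircleScalar W (X j) * encircleScalar W' (X j) := by
  rw [encircleScalar, encircle_tensor, scalar_comp (finrank_end hX j)]
  rfl

lemma encircleScalar_unit (W : C) : encircleScalar W (𝟙_ C) = dim W := by
  rw [encircleScalar, encircle_unit, dim, tr_apply]

/-- The sum of the loops coloured by all simple objects, weighted by dimension, absorbs any other
loop: loops multiply like tensor products, and the dimensions form an eigenvector of tensoring. -/
lemma encircleScalar_mul_sum [Spherical C] (hX : IsCompleteListOfSimples X) (l j : Fin r) :
    encircleScalar (X l) (X j) * ∑ i, dim (X i) * encircleScalar (X i) (X j) =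
      dim (X l) * ∑ i, dim (X i) * encircleScalar (X i) (X j) := by
  calc encircleScalar (X l) (X j) * ∑ i, dim (X i) * encircleScalar (X i) (X j)
      = ∑ i, dim (X i) * encircleScalar (X i ⊗ X l) (X j) := by
        rw [Finset.mul_sum]
        exact Finset.sum_congr rfl fun i _ => by rw [encircleScalar_tensor hX]; ring
    _ = ∑ i, ∑ m, dim (X i) * (mult X (X i ⊗ X l) m * encircleScalar (X m) (X j)) := by
        refine Finset.sum_congr rfl fun i _ => ?_
        rw [encircleScalar_eq_sum hX, Finset.mul_sum]
    _ = ∑ m, (∑ i, dim (X i) * mult X (X i ⊗ X l) m) * encircleScalar (X m) (X j) := by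
        rw [Finset.sum_comm]
        refine Finset.sum_congr rfl fun m _ => ?_
        rw [Finset.sum_mul]
        exact Finset.sum_congr rfl fun i _ => by ring
    _ = _ := by
        rw [Finset.mul_sum]
        exact Finset.sum_congr rfl fun m _ => by rw [sum_dim_mul_mult hX]; ring

end Braided

/-! ### Consequences of modularity -/

section Modular

variable {C : Type u} [Category.{v} C] [Abelian C] [Linear ℂ C] [MonoidalCategory C]
  [MonoidalPreadditive C] [MonoidalLinear ℂ C] [RightRigidCategory C] [BraidedCategory C]
  [PivotalCategory C] [ModularTensorCategory C]

variable {r : ℕ} {X : Fin r → C}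

/-- Modularity in terms of loops: up to the factors `dim (X j)`, the `S`-matrix lists the scalars by
which loops act, so a vector in the kernel vanishes. -/
lemma eq_zero_of_sum_encircleScalar (hX : IsCompleteListOfSimples X) (v : Fin r → ℂ)
    (h : ∀ i, ∑ j, encircleScalar (dual (X i)) (X j) * dim (X j) * v j = 0) : v = 0 := by
  let s : Matrix (Fin r) (Fin r) ℂ := fun i j => encircleScalar (dual (X i)) (X j) * dim (X j)
  have hs : s.det ≠ 0 := by
    refine ModularTensorCategory.sMatrix_nonsingular r X hX s fun i i' => ?_
    have h1 : tr (X i') (encircle (dual (X i)) (X i')) = s i i' := by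
      rw [eq_scalar_smul_id (finrank_end hX i') (encircle _ _), map_smul]
      rfl
    rw [Spherical.leftTrace_eq_rightTrace, rightTrace_comm, rightTrace_tensor, ← h1, tr_apply]
    exact (eq_scalar_smul_id (finrank_end_unit C) _).symm
  by_contra hv
  exact hs (Matrix.exists_mulVec_eq_zero_iff.mp ⟨v, hv, funext h⟩)

lemma dim_ne_zero (hX : IsCompleteListOfSimples X) (j : Fin r) : dim (X j) ≠ 0 := by
  intro hj
  have h := eq_zero_of_sum_encircleScalar hX (Pi.single j 1) fun i => by simp [Pi.single_apply, hj]
  simpa using congrFun h j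

/-- The killing property: the sum of the loops coloured by all simple objects, weighted by
dimension, annihilates every non-trivial simple object.  On an object where it did not vanish, all
loops would act by their dimensions, as on the unit object, which modularity excludes. -/
lemma sum_dim_mul_encircleScalar (hX : IsCompleteListOfSimples X) {i₀ : Fin r} (h₀ : X i₀ = 𝟙_ C)
    (j : Fin r) :
    ∑ i, dim (X i) * encircleScalar (X i) (X j) = if i₀ = j then globalDim X else 0 := by
  split_ifs with hj
  · rw [← hj, h₀, globalDim]
    exact Finset.sum_congr rfl fun i _ => by rw [encircleScalar_unit, sq]
  · by_contra hK
    have h1 : ∀ l, encircleScalar (X l) (X j) = dim (X l) := fun l =>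
      mul_right_cancel₀ hK (encircleScalar_mul_sum hX l j)
    have h2 : ∀ W : C, encircleScalar W (X j) = dim W := fun W => by
      rw [encircleScalar_eq_sum hX, dim_eq_sum hX]; simp only [h1]
    -- the columns of the `S`-matrix at `i₀` and `j` would be proportional
    have h := eq_zero_of_sum_encircleScalar hX
        (Pi.single j 1 - Pi.single i₀ (dim (X j))) fun i => by
      simp [Pi.single_apply, mul_sub, Finset.sum_sub_distrib, h2, h₀, encircleScalar_unit,
        dim_unit (finrank_end_unit C)]
    have := congrFun h j
    simp [Ne.symm hj] at this

/-- A positive curl on the left is the twist, too: on a simple object both are scalars, and by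
sphericity they have the same trace, so they agree because the dimension is not zero. -/
lemma ptrLeft_braiding (V : C) : ptrLeft V (β_ V V).hom = (tw V).hom := by
  obtain ⟨r, X, hX⟩ := FusionCategory.finitely_many_simples (C := C)
  have h1 : ∀ i, ptrLeft (X i) (β_ (X i) (X i)).hom = (tw (X i)).hom := by
    intro i
    have h2 : tr (X i) (ptrLeft (X i) (β_ (X i) (X i)).hom) = tr (X i) (tw (X i)).hom := by
      rw [tr_apply, tr_apply, ← Spherical.leftTrace_eq_rightTrace, ← leftTrace_tensor,
        Spherical.leftTrace_eq_rightTrace, rightTrace_tensor, ptr_braiding]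
    rw [eq_scalar_smul_id (finrank_end hX i) (ptrLeft _ _),
      eq_scalar_smul_id (finrank_end hX i) (tw _).hom] at h2 ⊢
    rw [map_smul, map_smul] at h2
    rw [mul_right_cancel₀ (dim_ne_zero hX i) h2]
  obtain ⟨D⟩ := hX.nonempty_decomposition V
  rw [← Category.comp_id (ptrLeft _ _), ← Category.comp_id (tw V).hom, ← D.sum_p_i,
    Preadditive.comp_sum, Preadditive.comp_sum]
  refine Finset.sum_congr rfl fun a _ => ?_
  rw [← reassoc_of% (ptrLeft_braiding_naturality (D.p a)),
    ← reassoc_of% (tw_naturality (D.p a)), h1]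

end Modular

/-! ### Vafa's relation and the absolute values of the twists -/

section Eigenvalues

/-- If an endomorphism of `Z` acts by scalars `c a` on objects `Y a` of which `Z` is a direct sum,
then the determinant of its action on `Z ⟶ L` is a product of numbers `c a`. -/
lemma exists_det_leftComp_eq_prod {C : Type u} [Category.{v} C] [Preadditive C] [Linear ℂ C]
    {Z L : C} [Module.Finite ℂ (Z ⟶ L)] {n : ℕ} {Y : Fin n → C} (ι : ∀ a, Y a ⟶ Z)
    (π : ∀ a, Z ⟶ Y a) (hsum : ∑ a, π a ≫ ι a = 𝟙 Z) (f : Z ⟶ Z) (c : Fin n → ℂ)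
    (hc : ∀ a, ι a ≫ f = c a • ι a) :
    ∃ s : Multiset ℂ, LinearMap.det (Linear.leftComp ℂ L f) = s.prod ∧
      Multiset.card s = finrank ℂ (Z ⟶ L) ∧ ∀ μ ∈ s, ∃ a, μ = c a := by
  set T : Module.End ℂ (Z ⟶ L) := Linear.leftComp ℂ L f
  have hs : T.charpoly.Splits := IsAlgClosed.splits _
  refine ⟨T.charpoly.roots, Module.End.det_eq_prod_roots_charpoly_of_splits hs, ?_, fun μ hμ => ?_⟩
  · rw [← hs.natDegree_eq_card_roots, LinearMap.charpoly_natDegree]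
  · have h1 : T.HasEigenvalue μ := by
      rw [Module.End.hasEigenvalue_iff_isRoot_charpoly]
      exact Polynomial.isRoot_of_mem_roots hμ
    obtain ⟨h, hh⟩ := h1.exists_hasEigenvector
    have h2 : f ≫ h = μ • h := hh.apply_eq_smul
    have h3 : ∃ a, ι a ≫ h ≠ 0 := by
      by_contra! h0
      refine hh.2 ?_
      rw [← Category.id_comp h, ← hsum, Preadditive.sum_comp]
      exact Finset.sum_eq_zero fun a _ => by rw [Category.assoc, h0, comp_zero]
    obtain ⟨a, ha⟩ := h3
    refine ⟨a, smul_left_injective ℂ ha ?_⟩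
    have h4 := ι a ≫= h2
    rw [← Category.assoc, hc, Linear.smul_comp, Linear.comp_smul] at h4
    exact h4.symm

lemma norm_multiset_prod_le_pow {s : Multiset ℂ} {m : ℝ} (h : ∀ x ∈ s, ‖x‖ ≤ m) :
    ‖s.prod‖ ≤ m ^ Multiset.card s := by
  induction s using Multiset.induction_on with
  | empty => simp
  | cons a s ih =>
    have ha := h a (Multiset.mem_cons_self a s)
    rw [Multiset.prod_cons, Multiset.card_cons, norm_mul, pow_succ']
    exact mul_le_mul ha (ih fun x hx => h x (Multiset.mem_cons_of_mem hx)) (norm_nonneg _)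
      ((norm_nonneg _).trans ha)

lemma pow_le_norm_multiset_prod {s : Multiset ℂ} {m : ℝ} (hm : 0 ≤ m) (h : ∀ x ∈ s, m ≤ ‖x‖) :
    m ^ Multiset.card s ≤ ‖s.prod‖ := by
  induction s using Multiset.induction_on with
  | empty => simp
  | cons a s ih =>
    rw [Multiset.prod_cons, Multiset.card_cons, norm_mul, pow_succ']
    exact mul_le_mul (h a (Multiset.mem_cons_self a s))
      (ih fun x hx => h x (Multiset.mem_cons_of_mem hx)) (pow_nonneg hm _) (norm_nonneg _)

end Eigenvalues

section Vafa

variable {C : Type u} [Category.{v} C] [Abelian C] [Linear ℂ C] [MonoidalCategory C]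
  [MonoidalPreadditive C] [MonoidalLinear ℂ C] [RightRigidCategory C] [BraidedCategory C]
  [PivotalCategory C] [FusionCategory C]

variable {r : ℕ} {X : Fin r → C}

/-- The twist of a threefold tensor product is the product of the twists of the three twofold ones,
up to the twists of the factors and up to conjugation. -/
lemma smul_tw_tensor_tensor {A B D : C} {a b d : ℂ} (ha : (tw A).hom = a • 𝟙 A)
    (hb : (tw B).hom = b • 𝟙 B) (hd : (tw D).hom = d • 𝟙 D) :
    (a * b * d) • (tw (A ⊗ (B ⊗ D))).hom =
      (((α_ A B D).inv ≫ (β_ A B).hom ▷ D ≫ (α_ B A D).hom) ≫ B ◁ (tw (A ⊗ D)).hom ≫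
        ((α_ B A D).inv ≫ (β_ A B).inv ▷ D ≫ (α_ A B D).hom)) ≫
      ((α_ A B D).inv ≫ (tw (A ⊗ B)).hom ▷ D ≫ (α_ A B D).hom) ≫ A ◁ (tw (B ⊗ D)).hom := by
  have h1 : (tw (A ⊗ D)).hom = (a * d) • monodromy A D := by
    rw [tw_tensor, ha, hd, MonoidalCategory.tensorHom_def]
    simp [smul_smul, mul_comm]
  have h2 : (tw (A ⊗ B)).hom = (a * b) • monodromy A B := by
    rw [tw_tensor, ha, hb, MonoidalCategory.tensorHom_def]
    simp [smul_smul, mul_comm]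
  have h3 : (tw (A ⊗ (B ⊗ D))).hom = a • (monodromy A (B ⊗ D) ≫ A ◁ (tw (B ⊗ D)).hom) := by
    rw [tw_tensor, ha, MonoidalCategory.tensorHom_def]
    simp
  have h4 : (β_ A B).inv ▷ D ≫ monodromy A B ▷ D = (β_ B A).hom ▷ D := by
    rw [← comp_whiskerRight, monodromy, Iso.inv_hom_id_assoc]
  rw [h1, h2, h3, monodromy_tensor_right]
  simp only [MonoidalLinear.whiskerLeft_smul, MonoidalLinear.smul_whiskerRight, Linear.smul_comp,
    Linear.comp_smul, smul_smul, Category.assoc, Iso.hom_inv_id_assoc, reassoc_of% h4]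
  congr 1
  ring

/-- Vafa's relation: the twists of `A`, `B`, `D`, `L`, raised to the dimension `N` of a space of
morphisms, multiply up to a product of `3 * N` twists of simple objects.  It compares determinants
on that space in `smul_tw_tensor_tensor`. -/
lemma exists_pow_finrank_eq_prod (hX : IsCompleteListOfSimples X) {A B D L : C} {a b d l : ℂ}
    (ha : (tw A).hom = a • 𝟙 A) (hb : (tw B).hom = b • 𝟙 B) (hd : (tw D).hom = d • 𝟙 D)
    (hl : (tw L).hom = l • 𝟙 L) :
    ∃ s : Multiset ℂ, (a * b * d * l) ^ finrank ℂ (A ⊗ (B ⊗ D) ⟶ L) = s.prod ∧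
      Multiset.card s = 3 * finrank ℂ (A ⊗ (B ⊗ D) ⟶ L) ∧ ∀ μ ∈ s, ∃ k, μ = theta (X k) := by
  obtain ⟨E₁⟩ := hX.nonempty_decomposition (A ⊗ D)
  obtain ⟨E₂⟩ := hX.nonempty_decomposition (A ⊗ B)
  obtain ⟨E₃⟩ := hX.nonempty_decomposition (B ⊗ D)
  have hi : ∀ {Z : C} (E : Decomposition X Z) (k : Fin E.n),
      E.i k ≫ (tw Z).hom = theta (X (E.s k)) • E.i k := by
    intro Z E k
    rw [tw_naturality, tw_hom_eq hX]; simp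
  set q := (α_ A B D).inv ≫ (β_ A B).hom ▷ D ≫ (α_ B A D).hom with hq
  set q' := (α_ B A D).inv ≫ (β_ A B).inv ▷ D ≫ (α_ A B D).hom with hq'
  have hqq' : q ≫ q' = 𝟙 _ := by simp [hq, hq']
  have hq'q : q' ≫ q = 𝟙 _ := by simp [hq, hq']
  obtain ⟨s₁, h₁, c₁, m₁⟩ := exists_det_leftComp_eq_prod (L := L) (fun k => B ◁ E₁.i k ≫ q')
    (fun k => q ≫ B ◁ E₁.p k) (by
      have : ∀ k, (q ≫ B ◁ E₁.p k) ≫ B ◁ E₁.i k ≫ q' = q ≫ (B ◁ (E₁.p k ≫ E₁.i k)) ≫ q' := by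
        intro k; simp
      simp_rw [this]
      rw [← Preadditive.comp_sum, ← Preadditive.sum_comp, ← whiskerLeft_sum, E₁.sum_p_i]
      simp [hqq']) (q ≫ B ◁ (tw (A ⊗ D)).hom ≫ q') (fun k => theta (X (E₁.s k))) (by
      intro k
      rw [Category.assoc, reassoc_of% hq'q, ← MonoidalCategory.whiskerLeft_comp_assoc, hi]
      simp)
  obtain ⟨s₂, h₂, c₂, m₂⟩ := exists_det_leftComp_eq_prod (L := L)
    (fun k => E₂.i k ▷ D ≫ (α_ A B D).hom) (fun k => (α_ A B D).inv ≫ E₂.p k ▷ D) (by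
      have : ∀ k, ((α_ A B D).inv ≫ E₂.p k ▷ D) ≫ E₂.i k ▷ D ≫ (α_ A B D).hom =
          (α_ A B D).inv ≫ ((E₂.p k ≫ E₂.i k) ▷ D) ≫ (α_ A B D).hom := by
        intro k; simp
      simp_rw [this]
      rw [← Preadditive.comp_sum, ← Preadditive.sum_comp, ← sum_whiskerRight, E₂.sum_p_i]
      simp) ((α_ A B D).inv ≫ (tw (A ⊗ B)).hom ▷ D ≫ (α_ A B D).hom)
      (fun k => theta (X (E₂.s k))) (by
      intro k
      rw [Category.assoc, Iso.hom_inv_id_assoc, ← comp_whiskerRight_assoc, hi]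
      simp)
  obtain ⟨s₃, h₃, c₃, m₃⟩ := exists_det_leftComp_eq_prod (L := L)
    (fun k => A ◁ E₃.i k) (fun k => A ◁ E₃.p k) (by
      simp_rw [← MonoidalCategory.whiskerLeft_comp]
      rw [← whiskerLeft_sum, E₃.sum_p_i]
      simp) (A ◁ (tw (B ⊗ D)).hom) (fun k => theta (X (E₃.s k))) (by
      intro k
      rw [← MonoidalCategory.whiskerLeft_comp, hi]
      simp)
  refine ⟨s₁ + (s₂ + s₃), ?_, by simp only [Multiset.card_add]; omega, ?_⟩
  · have h := congrArg (fun f => LinearMap.det (Linear.leftComp ℂ L f))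
      (smul_tw_tensor_tensor ha hb hd)
    have hcomp : ∀ f g : A ⊗ (B ⊗ D) ⟶ A ⊗ (B ⊗ D), Linear.leftComp ℂ L (f ≫ g) =
        Linear.leftComp ℂ L f ∘ₗ Linear.leftComp ℂ L g := by
      intro f g; ext h; simp
    have hl' : Linear.leftComp ℂ L ((a * b * d) • (tw (A ⊗ (B ⊗ D))).hom) =
        (a * b * d * l) • LinearMap.id := by
      ext g
      rw [Linear.leftComp_apply, Linear.smul_comp, ← tw_naturality, hl]
      simp [smul_smul]
    simp only [← hq, ← hq'] at h
    rw [hl', hcomp, hcomp _ (A ◁ _), LinearMap.det_comp, LinearMap.det_comp, h₁, h₂, h₃,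
      LinearMap.det_smul, LinearMap.det_id, mul_one] at h
    rw [h, Multiset.prod_add, Multiset.prod_add]
  · intro μ hμ
    rcases Multiset.mem_add.mp hμ with hμ | hμ
    · obtain ⟨k, hk⟩ := m₁ μ hμ; exact ⟨_, hk⟩
    rcases Multiset.mem_add.mp hμ with hμ | hμ
    · obtain ⟨k, hk⟩ := m₂ μ hμ; exact ⟨_, hk⟩
    · obtain ⟨k, hk⟩ := m₃ μ hμ; exact ⟨_, hk⟩

end Vafa

section AbsoluteValue

variable {C : Type u} [Category.{v} C] [Abelian C] [Linear ℂ C] [MonoidalCategory C]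
  [MonoidalPreadditive C] [MonoidalLinear ℂ C] [RightRigidCategory C] [BraidedCategory C]
  [PivotalCategory C] [ModularTensorCategory C]

variable {r : ℕ} {X : Fin r → C}

/-- If the twist of `V` is a scalar, then the twist of `dual V` is the same scalar: the two ways of
rotating `coev V`, with the positive and with the negative braiding, agree, and the balancing axiom
evaluates the double braiding between them. -/
lemma tw_dual_of_eq_smul {V : C} {t : ℂ} (ht : t ≠ 0) (hV : (tw V).hom = t • 𝟙 V) :
    (tw (dual V)).hom = t • 𝟙 (dual V) := by
  have h0 : (tw V).inv = t⁻¹ • 𝟙 V := by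
    rw [← cancel_epi (tw V).hom, Iso.hom_inv_id, hV]
    simp [smul_smul, inv_mul_cancel₀ ht]
  have h1 : coev V ≫ (tw V).hom ▷ dual V ≫ monodromy V (dual V) = coev V ≫ (tw V).inv ▷ dual V := by
    have h := (rotate_eq_braiding (coev V)).symm.trans (rotate_eq_braiding_inv (coev V))
    rw [ptrLeft_braiding] at h
    have h' := h =≫ (β_ (dual V) V).hom
    simpa only [Category.assoc, Iso.inv_hom_id, Category.comp_id, monodromy] using h'
  have h2 : coev V ≫ monodromy V (dual V) ≫ ((tw V).hom ⊗ₘ (tw (dual V)).hom) = coev V := by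
    rw [← tw_tensor, tw_naturality, tw_unit, Category.id_comp]
  have h3 : coev V ≫ V ◁ (tw (dual V)).hom = t • coev V := by
    rw [MonoidalCategory.tensorHom_def, ← reassoc_of% monodromy_naturality_left (tw V).hom (dual V),
      reassoc_of% h1, h0] at h2
    conv_rhs => rw [← h2]
    simp [smul_smul, mul_inv_cancel₀ ht]
  calc (tw (dual V)).hom
      = 𝟙 _ ⊗≫ ((dual V ◁ coev V ⊗≫ ev V ▷ dual V) ⊗≫ (tw (dual V)).hom) ⊗≫ 𝟙 _ := by
        rw [zigzag_ev_coev]; monoidal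
    _ = 𝟙 _ ⊗≫ dual V ◁ coev V ⊗≫ (ev V ▷ dual V ≫ 𝟙_ C ◁ (tw (dual V)).hom) ⊗≫ 𝟙 _ := by
        monoidal
    _ = (ρ_ _).inv ≫ dual V ◁ (coev V ≫ V ◁ (tw (dual V)).hom) ≫ (α_ _ _ _).inv ≫
          ev V ▷ dual V ≫ (λ_ _).hom := by
        rw [← whisker_exchange]; monoidal
    _ = t • ((ρ_ _).inv ≫ (dual V ◁ coev V ≫ (α_ _ _ _).inv ≫
          ev V ▷ dual V) ≫ (λ_ _).hom) := by
        rw [h3]; simp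
    _ = _ := by
        rw [ExactPairing.coevaluation_evaluation]; simp

/-- The space of morphisms used in Vafa's relation is not zero. -/
lemma finrank_pos (hX : IsCompleteListOfSimples X) (i : Fin r) :
    0 < finrank ℂ (X i ⊗ (dual (X i) ⊗ X i) ⟶ X i) := by
  have h : X i ◁ ev (X i) ≫ (ρ_ (X i)).hom ≠ 0 := by
    intro h0
    have := hX.simple i
    apply id_nonzero (X i)
    have h1 := ExactPairing.evaluation_coevaluation (X i) (dual (X i))
    calc 𝟙 (X i) = (λ_ _).inv ≫ (coev (X i) ▷ X i ≫ (α_ _ _ _).hom ≫ X i ◁ ev (X i)) ≫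
          (ρ_ (X i)).hom := by rw [h1]; simp
      _ = 0 := by simp only [Category.assoc, h0, comp_zero]
  have : Nontrivial (X i ⊗ (dual (X i) ⊗ X i) ⟶ X i) := ⟨_, 0, h⟩
  exact Module.finrank_pos

/-- The twists of the simple objects have absolute value one: Vafa's relation for `X k`, its dual
and two more copies of `X k` equates a product of `4 * N` factors of absolute value
`‖theta (X k)‖` with a product of `3 * N` twists of simple objects, which is impossible for a
maximum above one or a minimum below one. -/
lemma norm_theta (hX : IsCompleteListOfSimples X) (i : Fin r) : ‖theta (X i)‖ = 1 := by
  have key : ∀ i, ∃ n, 0 < n ∧ ∃ s : Multiset ℂ, ‖theta (X i)‖ ^ (4 * n) = ‖s.prod‖ ∧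
      Multiset.card s = 3 * n ∧ ∀ μ ∈ s, ∃ k, μ = theta (X k) := by
    intro i
    obtain ⟨s, h1, h2, h3⟩ := exists_pow_finrank_eq_prod hX (tw_hom_eq hX i)
      (tw_dual_of_eq_smul (theta_ne_zero hX i) (tw_hom_eq hX i))
      (tw_hom_eq hX i) (tw_hom_eq hX i)
    refine ⟨_, finrank_pos hX i, s, ?_, h2, h3⟩
    rw [← h1, norm_pow, pow_mul]
    congr 1
    simp only [norm_mul]
    ring
  have : Nonempty (Fin r) := ⟨i⟩
  apply le_antisymm
  · obtain ⟨k, hk⟩ := Finite.exists_max fun k => ‖theta (X k)‖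
    refine (hk i).trans ?_
    obtain ⟨n, hn, s, h1, h2, h3⟩ := key k
    have h4 : ‖s.prod‖ ≤ ‖theta (X k)‖ ^ Multiset.card s :=
      norm_multiset_prod_le_pow fun x hx => by obtain ⟨l, rfl⟩ := h3 x hx; exact hk l
    rw [← h1, h2] at h4
    by_contra! h5
    exact absurd h4 (not_le.mpr (pow_lt_pow_right₀ h5 (by omega)))
  · obtain ⟨k, hk⟩ := Finite.exists_min fun k => ‖theta (X k)‖
    refine le_trans ?_ (hk i)
    obtain ⟨n, hn, s, h1, h2, h3⟩ := key k
    have h4 : ‖theta (X k)‖ ^ Multiset.card s ≤ ‖s.prod‖ :=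
      pow_le_norm_multiset_prod (norm_nonneg _) fun x hx => by
        obtain ⟨l, rfl⟩ := h3 x hx; exact hk l
    rw [← h1, h2] at h4
    by_contra! h5
    exact absurd h4 (not_le.mpr (pow_lt_pow_right_of_lt_one₀
      (norm_pos_iff.mpr (theta_ne_zero hX k)) h5 (by omega)))

end AbsoluteValue

/-! ### Bantay's formula and the exponent -/

section Exponent

variable {C : Type u} [Category.{v} C] [Abelian C] [Linear ℂ C] [MonoidalCategory C]
  [MonoidalPreadditive C] [MonoidalLinear ℂ C] [RightRigidCategory C] [BraidedCategory C]
  [PivotalCategory C] [ModularTensorCategory C]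

variable {r : ℕ} {X : Fin r → C}

variable (C) in
/-- The unit object itself can be taken as one of the representatives of the simple objects. -/
lemma exists_completeListOfSimples_unit : ∃ (r : ℕ) (X : Fin r → C) (i₀ : Fin r),
    IsCompleteListOfSimples X ∧ X i₀ = 𝟙_ C := by
  obtain ⟨r, X, hX⟩ := FusionCategory.finitely_many_simples (C := C)
  obtain ⟨i₀, ⟨e⟩⟩ := hX.exists_iso (𝟙_ C) FusionCategory.unit_simple
  have h : ∀ i, Nonempty (Function.update X i₀ (𝟙_ C) i ≅ X i) := by
    intro i
    by_cases hi : i = i₀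
    · subst hi; exact ⟨eqToIso (Function.update_self ..) ≪≫ e⟩
    · exact ⟨eqToIso (Function.update_of_ne hi ..)⟩
  refine ⟨r, Function.update X i₀ (𝟙_ C), i₀, ⟨fun i => ?_, fun i i' ⟨f⟩ => ?_, fun V hV => ?_⟩,
    Function.update_self ..⟩
  · have := hX.simple i
    exact Simple.of_iso (h i).some
  · exact hX.eq_of_iso i i' ⟨(h i).some.symm ≪≫ f ≪≫ (h i').some⟩
  · obtain ⟨i, ⟨f⟩⟩ := hX.exists_iso V hV
    exact ⟨i, ⟨f ≪≫ (h i).some.symm⟩⟩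

/-- The operator defining the indicators is composition with the twisted cyclic braid. -/
lemma fsOperator_eq (V : C) (n : ℕ) : fsOperator ℂ V n =
    Linear.rightComp ℂ (𝟙_ C) ((tw V).hom ▷ tensorPow V n ≫ cyclicBraid V n) := by
  refine LinearMap.ext fun f => ?_
  refine (congrArg (· ≫ (tensorPowComm V n).hom)
    (rotate_eq_braiding (V := V) (W := tensorPow V n) f)).trans ?_
  rw [ptrLeft_braiding]
  simp only [cyclicBraid]
  exact (Category.assoc _ _ _).trans (congrArg (f ≫ ·) (Category.assoc _ _ _))

lemma trace_rightComp_unit (hX : IsCompleteListOfSimples X) {i₀ : Fin r} {U A : C} (h₀ : X i₀ = U)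
    (D : Decomposition X A) (f : A ⟶ A) :
    LinearMap.trace ℂ (U ⟶ A) (Linear.rightComp ℂ U f) =
      ∑ a, if i₀ = D.s a then scalar (X (D.s a)) (D.i a ≫ f ≫ D.p a) else 0 := by
  subst h₀
  exact trace_rightComp hX D i₀ f

/-- Bantay's formula for the indicators.  The killing property turns the trace over `Hom(𝟙, V^{⊗n})`
into a sum of traces of the twisted cyclic braid with a loop `X i` around all strands, and each of
these is the trace of `V` winding `n` times around `X i`. -/
lemma globalDim_mul_fsIndicator (hX : IsCompleteListOfSimples X) {i₀ : Fin r} (h₀ : X i₀ = 𝟙_ C)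
    (V : C) {n : ℕ} (hn : 0 < n) :
    globalDim X * fsIndicator ℂ V n =
      ∑ i, dim (X i) * ((theta (X i))⁻¹ ^ n * tr (X i ⊗ V) (compPow (tw (X i ⊗ V)).hom n)) := by
  obtain ⟨n, rfl⟩ := Nat.exists_eq_succ_of_ne_zero hn.ne'
  set φ := (tw V).hom ▷ tensorPow V n ≫ cyclicBraid V n with hφ
  obtain ⟨D⟩ := hX.nonempty_decomposition (V ⊗ tensorPow V n)
  have h1 : ∀ i, (theta (X i))⁻¹ ^ (n + 1) *
      tr (X i ⊗ V) (compPow (tw (X i ⊗ V)).hom (n + 1)) =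
      ∑ a, scalar (X (D.s a)) (D.i a ≫ φ ≫ D.p a) *
        (encircleScalar (X i) (X (D.s a)) * dim (X (D.s a))) := by
    intro i
    rw [← tr_comp_encircle hX, tr_apply (φ ≫ _), hφ, rightTrace_cyclicBraid_encircle, ← tr_apply,
      tw_inv_eq hX, compPow_smul_id]
    simp
  have h2 : fsIndicator ℂ V (n + 1) =
      ∑ a, if i₀ = D.s a then scalar (X (D.s a)) (D.i a ≫ φ ≫ D.p a) else 0 := by
    rw [← trace_rightComp_unit hX h₀ D φ, hφ, ← fsOperator_eq]
    rfl
  have hd : dim (X i₀) = 1 := by rw [h₀, dim_unit (finrank_end_unit C)]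
  calc globalDim X * fsIndicator ℂ V (n + 1)
      = ∑ a, scalar (X (D.s a)) (D.i a ≫ φ ≫ D.p a) * dim (X (D.s a)) *
          ∑ i, dim (X i) * encircleScalar (X i) (X (D.s a)) := by
        rw [h2, Finset.mul_sum]
        refine Finset.sum_congr rfl fun a _ => ?_
        rw [sum_dim_mul_encircleScalar hX h₀]
        split_ifs with h
        · have hda : dim (X (D.s a)) = 1 := by rw [← h, hd]
          rw [hda]; ring
        · ring
    _ = ∑ i, dim (X i) * ∑ a, scalar (X (D.s a)) (D.i a ≫ φ ≫ D.p a) *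
          (encircleScalar (X i) (X (D.s a)) * dim (X (D.s a))) := by
        simp only [Finset.mul_sum]
        rw [Finset.sum_comm]
        exact Finset.sum_congr rfl fun i _ => Finset.sum_congr rfl fun a _ => by ring
    _ = _ := Finset.sum_congr rfl fun i _ => by rw [h1]

lemma tr_tensor_compPow_tw (hX : IsCompleteListOfSimples X) (A V : C) (n : ℕ) :
    tr (A ⊗ V) (compPow (tw (A ⊗ V)).hom n) =
      ∑ k, (mult X V k : ℂ) * tr (A ⊗ X k) (compPow (tw (A ⊗ X k)).hom n) := by
  obtain ⟨D⟩ := hX.nonempty_decomposition V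
  rw [← sum_decomposition hX D (fun k => tr (A ⊗ X k) (compPow (tw (A ⊗ X k)).hom n))]
  have h : compPow (tw (A ⊗ V)).hom n =
      ∑ a, (compPow (tw (A ⊗ V)).hom n ≫ A ◁ D.p a) ≫ A ◁ D.i a := by
    simp only [Category.assoc, ← MonoidalCategory.whiskerLeft_comp]
    rw [← Preadditive.comp_sum, ← whiskerLeft_sum, D.sum_p_i]
    simp
  conv_lhs => rw [h, map_sum]
  refine Finset.sum_congr rfl fun a _ => ?_
  rw [tr_comm, ← Category.assoc, comp_compPow (tw_naturality (A ◁ D.i a)), Category.assoc,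
    ← MonoidalCategory.whiskerLeft_comp, D.i_p_self]
  simp

lemma fsIndicator_eq_sum (hX : IsCompleteListOfSimples X) {i₀ : Fin r} (h₀ : X i₀ = 𝟙_ C)
    (V : C) {n : ℕ} (hn : 0 < n) :
    fsIndicator ℂ V n = ∑ k, (mult X V k : ℂ) * fsIndicator ℂ (X k) n := by
  apply mul_left_cancel₀ (globalDim_ne_zero hX)
  rw [globalDim_mul_fsIndicator hX h₀ V hn, Finset.mul_sum]
  have h : ∀ k, globalDim X * ((mult X V k : ℂ) * fsIndicator ℂ (X k) n) =
      ∑ i, (mult X V k : ℂ) * (dim (X i) * ((theta (X i))⁻¹ ^ n *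
        tr (X i ⊗ X k) (compPow (tw (X i ⊗ X k)).hom n))) := by
    intro k
    rw [mul_left_comm, globalDim_mul_fsIndicator hX h₀ (X k) hn, Finset.mul_sum]
  simp only [h]
  rw [Finset.sum_comm]
  refine Finset.sum_congr rfl fun i _ => ?_
  rw [tr_tensor_compPow_tw hX, Finset.mul_sum, Finset.mul_sum]
  exact Finset.sum_congr rfl fun k _ => by ring

lemma twist_pow_app (n : ℕ) (V : C) : (twist C ^ n).hom.app V = compPow (tw V).hom n := by
  induction n with
  | zero => rfl
  | succ n ih =>
    rw [pow_succ', compPow, ← ih]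
    rfl

lemma twist_pow_eq_one_iff (hX : IsCompleteListOfSimples X) (n : ℕ) :
    twist C ^ n = 1 ↔ ∀ i, theta (X i) ^ n = 1 := by
  constructor
  · intro h i
    have h1 := twist_pow_app n (X i)
    rw [h, tw_hom_eq hX, compPow_smul_id] at h1
    rw [← scalar_smul_id (finrank_end hX i) (theta (X i) ^ n), ← h1]
    exact scalar_id (finrank_end hX i)
  · intro h
    ext V
    rw [twist_pow_app]
    change _ = 𝟙 V
    obtain ⟨D⟩ := hX.nonempty_decomposition V
    rw [← Category.comp_id (compPow _ _), ← D.sum_p_i, Preadditive.comp_sum]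
    refine Finset.sum_congr rfl fun a _ => ?_
    rw [← Category.assoc, ← comp_compPow (tw_naturality (D.p a)), tw_hom_eq hX, compPow_smul_id, h]
    simp

lemma fsIndicator_smul_eq_leftDim_iff (V : C) (n : ℕ) :
    fsIndicator ℂ V n • 𝟙 (𝟙_ C) = leftDim V ↔ fsIndicator ℂ V n = dim V := by
  have h : leftDim V = dim V • 𝟙 (𝟙_ C) := by
    rw [leftDim, Spherical.leftTrace_eq_rightTrace, dim, tr_apply]
    exact eq_scalar_smul_id (finrank_end_unit C) _
  rw [h]
  constructor
  · intro h1
    simpa only [scalar_smul_id (finrank_end_unit C)] using congrArg (scalar (𝟙_ C)) h1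
  · intro h1; rw [h1]

lemma fsIndicator_eq_dim (hX : IsCompleteListOfSimples X) {i₀ : Fin r} (h₀ : X i₀ = 𝟙_ C)
    (V : C) {n : ℕ} (hn : 0 < n) (h : ∀ i, theta (X i) ^ n = 1) : fsIndicator ℂ V n = dim V := by
  apply mul_left_cancel₀ (globalDim_ne_zero hX)
  rw [globalDim_mul_fsIndicator hX h₀ V hn, globalDim, Finset.sum_mul]
  refine Finset.sum_congr rfl fun i _ => ?_
  rw [tr_compPow_tw hX, inv_pow, h]
  simp only [h, one_mul]
  rw [← dim_eq_sum hX, dim_tensor (finrank_end_unit C)]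
  ring

lemma theta_unit : theta (𝟙_ C) = 1 := by
  rw [theta, tw_unit, scalar_id (finrank_end_unit C)]

lemma mult_congr {A B : C} (e : A ≅ B) (i : Fin r) : mult X A i = mult X B i :=
  (Linear.homCongr ℂ (Iso.refl (X i)) e).finrank_eq

/-- Bantay's formula for the simple objects, summed with their dimensions as weights. -/
lemma sum_dim_sq_mul_theta_pow (hX : IsCompleteListOfSimples X) {i₀ : Fin r} (h₀ : X i₀ = 𝟙_ C)
    {n : ℕ} (hn : 0 < n) (h : ∀ k, fsIndicator ℂ (X k) n = dim (X k)) :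
    ∑ i, ∑ j, dim (X i) ^ 2 * dim (X j) ^ 2 * ((theta (X i))⁻¹ ^ n * theta (X j) ^ n) =
      globalDim X ^ 2 := by
  have h1 : ∀ k, dim (X k) * (globalDim X * fsIndicator ℂ (X k) n) =
      ∑ i, ∑ j, dim (X i) * ((theta (X i))⁻¹ ^ n * (theta (X j) ^ n * dim (X j) *
        (dim (X k) * mult X (X k ⊗ X i) j))) := by
    intro k
    rw [globalDim_mul_fsIndicator hX h₀ (X k) hn, Finset.mul_sum]
    refine Finset.sum_congr rfl fun i _ => ?_
    rw [tr_compPow_tw hX, Finset.mul_sum, Finset.mul_sum, Finset.mul_sum]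
    refine Finset.sum_congr rfl fun j _ => ?_
    rw [mult_congr (β_ (X i) (X k))]
    ring
  have h2 : globalDim X ^ 2 = ∑ k, dim (X k) * (globalDim X * fsIndicator ℂ (X k) n) := by
    rw [sq]
    nth_rewrite 2 [globalDim]
    rw [Finset.mul_sum]
    exact Finset.sum_congr rfl fun k _ => by rw [h]; ring
  rw [h2]
  simp only [h1]
  symm
  rw [Finset.sum_comm]
  refine Finset.sum_congr rfl fun i _ => ?_
  rw [Finset.sum_comm]
  refine Finset.sum_congr rfl fun j _ => ?_
  rw [← Finset.mul_sum, ← Finset.mul_sum, ← Finset.mul_sum, sum_dim_mul_mult hX]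
  ring

/-- If the `n`-th indicators of all simple objects are their dimensions, then the twists of the
simple objects are `n`-th roots of unity: `sum_dim_sq_mul_theta_pow` is a case of equality in the
triangle inequality, as the weights are positive and the twists have absolute value one. -/
lemma theta_pow_eq_one (hX : IsCompleteListOfSimples X) {i₀ : Fin r} (h₀ : X i₀ = 𝟙_ C)
    {n : ℕ} (hn : 0 < n) (h : ∀ k, fsIndicator ℂ (X k) n = dim (X k)) (k : Fin r) :
    theta (X k) ^ n = 1 := by
  set x : Fin r → ℝ := fun i => (dim (X i)).re ^ 2 with hx
  have hdx : ∀ i, dim (X i) ^ 2 = (x i : ℂ) := by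
    intro i
    conv_lhs => rw [dim_eq_ofReal hX i]
    rw [hx]; push_cast; rfl
  have hx0 : ∀ i, 0 < x i := by
    intro i
    refine lt_of_le_of_ne (sq_nonneg _) fun h0 => dim_ne_zero hX i ?_
    have := hdx i
    rw [← h0] at this
    simpa using this
  set w : Fin r → Fin r → ℂ := fun i j => (theta (X i))⁻¹ ^ n * theta (X j) ^ n with hw
  have hw1 : ∀ i j, ‖w i j‖ = 1 := by
    intro i j; simp [hw, norm_theta hX]
  have h1 : ∑ i, ∑ j, x i * x j * (1 - (w i j).re) = 0 := by
    have h2 := sum_dim_sq_mul_theta_pow hX h₀ hn h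
    have h3 : globalDim X ^ 2 = ∑ i, ∑ j, (x i : ℂ) * x j := by
      rw [sq, globalDim, Finset.sum_mul_sum]
      simp only [hdx]
    rw [h3] at h2
    simp only [hdx] at h2
    have h4 := congrArg Complex.re h2
    simp only [Complex.re_sum, ← Complex.ofReal_mul, Complex.re_ofReal_mul, Complex.ofReal_re]
      at h4
    simp only [mul_sub, mul_one, Finset.sum_sub_distrib]
    rw [sub_eq_zero]
    exact h4.symm
  have hnn : ∀ i j, 0 ≤ x i * x j * (1 - (w i j).re) := fun i j =>
    mul_nonneg (mul_pos (hx0 i) (hx0 j)).le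
      (sub_nonneg.mpr ((Complex.re_le_norm _).trans (hw1 i j).le))
  have h5 : x i₀ * x k * (1 - (w i₀ k).re) = 0 :=
    (Finset.sum_eq_zero_iff_of_nonneg fun j _ => hnn i₀ j).mp
      ((Finset.sum_eq_zero_iff_of_nonneg fun i _ => Finset.sum_nonneg fun j _ => hnn i j).mp h1 i₀
        (Finset.mem_univ _)) k (Finset.mem_univ _)
  have h6 : (w i₀ k).re = 1 := by
    have := (mul_eq_zero.mp h5).resolve_left (mul_pos (hx0 i₀) (hx0 k)).ne'
    linarith
  have h7 : w i₀ k = 1 := by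
    have h8 := Complex.sq_norm (w i₀ k)
    rw [hw1, Complex.normSq_apply, h6] at h8
    apply Complex.ext
    · rw [h6, Complex.one_re]
    · rw [Complex.one_im]; nlinarith
  simpa [hw, h₀, theta_unit] using h7

attribute [local instance] Abelian.hasFiniteBiproducts in
/-- There is an object with prescribed multiplicities `m`, tested against functions `g`. -/
lemma exists_mult_eq (hX : IsCompleteListOfSimples X) (m : Fin r → ℕ) :
    ∃ V : C, ∀ g : Fin r → ℂ, ∑ k, (mult X V k : ℂ) * g k = ∑ k, (m k : ℂ) * g k := by
  let Y : (Σ k : Fin r, Fin (m k)) → C := fun x => X x.1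
  let e := (Fintype.equivFin (Σ k : Fin r, Fin (m k))).symm
  let D : Decomposition X (⨁ Y) :=
    { n := Fintype.card (Σ k : Fin r, Fin (m k))
      s := fun a => (e a).1
      i := fun a => biproduct.ι Y (e a)
      p := fun a => biproduct.π Y (e a)
      i_p_self := fun a => by simp [Y]
      sum_p_i := by
        rw [e.sum_comp (fun x => biproduct.π Y x ≫ biproduct.ι Y x), biproduct.total] }
  refine ⟨⨁ Y, fun g => ?_⟩
  rw [← sum_decomposition hX D]
  change ∑ a, g (e a).1 = _
  rw [e.sum_comp (fun x => g x.1), Fintype.sum_sigma]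
  simp

/-- If for each `n` in a finite set the indicator of some simple object is not its dimension, then
there is one object for which this holds for all these `n` at once.  In a direct sum of `t ^ k`
copies of `X k` the difference is a non-zero polynomial in `t` for each `n`, and some `t` avoids
the zeros of all of them. -/
lemma exists_fsIndicator_ne_dim (hX : IsCompleteListOfSimples X) {i₀ : Fin r} (h₀ : X i₀ = 𝟙_ C)
    (s : Finset ℕ) (hs : ∀ n ∈ s, 0 < n ∧ ∃ k, fsIndicator ℂ (X k) n ≠ dim (X k)) :
    ∃ V : C, ∀ n ∈ s, fsIndicator ℂ V n ≠ dim V := by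
  let c : ℕ → Fin r → ℂ := fun n k => fsIndicator ℂ (X k) n - dim (X k)
  let p : ℕ → Polynomial ℂ := fun n => ∑ k : Fin r, Polynomial.monomial (k : ℕ) (c n k)
  have hp : ∏ n ∈ s, p n ≠ 0 := by
    refine Finset.prod_ne_zero_iff.mpr fun n hn h => ?_
    obtain ⟨k, hk⟩ := (hs n hn).2
    have h1 := congrArg (fun q => Polynomial.coeff q (k : ℕ)) h
    simp only [p, Polynomial.finsetSum_coeff, Polynomial.coeff_monomial, Polynomial.coeff_zero,
      Fin.val_inj, Finset.sum_ite_eq', Finset.mem_univ, if_true] at h1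
    exact hk (sub_eq_zero.mp h1)
  obtain ⟨t, ht⟩ : ∃ t : ℕ, (∏ n ∈ s, p n).eval (t : ℂ) ≠ 0 := by
    by_contra! h
    refine hp (Polynomial.eq_zero_of_infinite_isRoot _ ?_)
    exact (Set.infinite_range_of_injective (Nat.cast_injective (R := ℂ))).mono
      (by rintro _ ⟨t, rfl⟩; exact h t)
  obtain ⟨V, hV⟩ := exists_mult_eq hX (fun k => t ^ (k : ℕ))
  refine ⟨V, fun n hn h => ?_⟩
  rw [Polynomial.eval_prod] at ht
  refine Finset.prod_ne_zero_iff.mp ht n hn ?_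
  have h1 := hV (c n)
  simp only [c, mul_sub, Finset.sum_sub_distrib] at h1
  rw [← fsIndicator_eq_sum hX h₀ V (hs n hn).1, ← dim_eq_sum hX, h, sub_self] at h1
  simp only [p, Polynomial.eval_finsetSum, Polynomial.eval_monomial, c]
  rw [h1, ← Finset.sum_sub_distrib]
  refine Finset.sum_congr rfl fun k _ => ?_
  push_cast
  ring

end Exponent

end FrobeniusSchur

end

theorem theoremt {C : Type u} [Category.{v} C] [Abelian C] [Linear ℂ C] [MonoidalCategory C]
    [MonoidalPreadditive C] [MonoidalLinear ℂ C] [RightRigidCategory C] [BraidedCategory C]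
    [FrobeniusSchur.PivotalCategory C] [FrobeniusSchur.ModularTensorCategory C] :
    FrobeniusSchur.fsExp ℂ C = FrobeniusSchur.order (FrobeniusSchur.twist C) := by
  open FrobeniusSchur in
  obtain ⟨r, X, i₀, hX, h₀⟩ := exists_completeListOfSimples_unit C
  apply le_antisymm
  · refine iSup_le fun V => le_iInf₂ fun n hn => iInf₂_le n ⟨hn.1, ?_⟩
    rw [fsIndicator_smul_eq_leftDim_iff]
    exact fsIndicator_eq_dim hX h₀ V hn.1 ((twist_pow_eq_one_iff hX n).mp hn.2)
  · by_contra! hlt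
    obtain ⟨N, hN⟩ := ENat.ne_top_iff_exists.mp hlt.ne_top
    -- no power of the twist up to the exponent of the category is trivial
    obtain ⟨V, hV⟩ := exists_fsIndicator_ne_dim hX h₀ (Finset.Icc 1 N) fun n hn => by
      rw [Finset.mem_Icc] at hn
      refine ⟨hn.1, ?_⟩
      by_contra! h
      have h1 : order (twist C) ≤ n :=
        iInf₂_le n ⟨hn.1, (twist_pow_eq_one_iff hX n).mpr (theta_pow_eq_one hX h₀ hn.1 h)⟩
      have h2 : (n : ℕ∞) ≤ N := by exact_mod_cast hn.2
      exact absurd (h1.trans h2) (not_le.mpr (hN ▸ hlt))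
    have h3 : ((N + 1 : ℕ) : ℕ∞) ≤ fsExpObj ℂ V := by
      refine le_iInf₂ fun n hn => ?_
      by_contra! h4
      have h5 : n < N + 1 := by exact_mod_cast h4
      exact hV n (Finset.mem_Icc.mpr ⟨hn.1, by omega⟩)
        ((fsIndicator_smul_eq_leftDim_iff V n).mp hn.2)
    have h6 : ((N + 1 : ℕ) : ℕ∞) ≤ N := by
      rw [hN]; exact h3.trans (le_iSup (fun V : C => fsExpObj ℂ V) V)
    have h7 : N + 1 ≤ N := by exact_mod_cast h6
    omega
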